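/- Let $V$ be a finite-dimensional real vector space and $V^*$ its dual. A convex polytope $$\Delta=\Delta(\kappa)=\bigcap_{i=1}^N\{x\in V:\langle\eta_i,x\rangle\le\kappa_i\},\qquad \eta_i\in V^*,\ \kappa\in\mathbb R^N,$$ with $F_i=\Delta\cap\{\langle\eta_i,x\rangle=\kappa_i\}$, is called *simple* if it is bounded, affinely spans $V$, the affine span of each $F_i$ is a hyperplane (in particular $F_i\neq\emptyset$), and exactly $\dim V$ of the facets $F_i$ meet at every vertex. Given an integer lattice $\ell\subset V^*$ (the integer span of a basis), a simple polytope is *smooth* if each $\eta_i$ has a positive multiple in $\ell$ and, at each vertex, the primitive outward conormals (the primitive elements of $\ell$ that are positive multiples of the $\eta_i$) of the facets meeting there form a basis of $\ell$. The *chamber* $\mathcal C_\Delta$ is the connected component containing $\kappa$ of the set of $\kappa'\in\mathbb R^N$ such that $\Delta(\kappa')$ is simple (with facets $F_1(\kappa'),\dots,F_N(\kappa')$), and $c_\Delta(\kappa')$ is the center of mass of $\Delta(\kappa')$. An element $H\in V^*$ is *mass linear* on $\Delta$ if there are $\gamma_i,C\in\mathbb R$ with $\langle H,c_\Delta(\kappa')\rangle=\sum_i\gamma_i\kappa'_i+C$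 for all $\kappa'\in\mathcal C_\Delta$. A *symmetry* of a polytope is an affine map $V\to V$ carrying the polytope onto itself; in the smooth case its linear part is also required to induce an automorphism of the dual lattice $\ell^*\subset V$. A *robust symmetry* of $\Delta$ is a linear map $\hat a:V\to V$ which, for every $\kappa'\in\mathcal C_\Delta$, is the linear part of a symmetry $a_{\kappa'}$ of $\Delta(\kappa')$. Facets $F_i,F_j$ are *equivalent* if there is a robust symmetry $\hat a$ such that $a_{\kappa'}(F_i(\kappa'))=F_j(\kappa')$ for all $\kappa'\in\mathcal C_\Delta$; this is an equivalence relation. Positive rescalings $\zeta_i$ of the conormals $\eta_i$ are *normalized* if for every robust symmetry $\hat a$ and every $i$ there is $j$ with $\hat a^*\zeta_i=\zeta_j$ (in the smooth case the primitive outward conormals are normalized). An element $H\in V^*$ is *inessential* on $\Delta$ if, for a normalized choice of conormals, $H=\sum_i\beta_i\zeta_i$ with $\beta_i\in\mathbb R$ and $\sum_{i\in I}\beta_i=0$ for every equivalence class $I$ of facets; this does not depend on the normalized choice. **Theorem.** Let $\Delta$ be a simple polytope, or a smooth polytope. In either case the following conditions are equivalent: 1. every $H\in V^*$ is mass linear on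 $\Delta$; 2. every $H\in V^*$ is inessential on $\Delta$; 3. $\Delta$ is a product of simplices, i.e. there is an affine isomorphism $V\cong\prod_j\mathbb R^{k_j}$ (a finite product) carrying $\Delta$ to $\prod_j\lambda_j\Delta_{k_j}$ for some $\lambda_j>0$, where $\lambda\Delta_k=\{x\in\mathbb R^k: x_i\ge0\ \forall i,\ \sum_i x_i\le\lambda\}$; in the smooth case the linear part of this isomorphism is moreover required to carry $\ell^*$ onto $\prod_j\mathbb Z^{k_j}$; 4. $\bigcap_{i\in I}F_i=\emptyset$ for every equivalence class $I$ of facets. In particular, if condition 4 holds, then $|I|>1$ for every equivalence class $I$. -/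

import Mathlib

/-!
Throughout, `V` plays the role of `𝔱*`, so that `𝔱` is `Module.Dual ℝ V`.  A polytope is presented by
a finite family of conormals `η : ι → Module.Dual ℝ V` and support numbers `κ : ι → ℝ`.
-/

namespace MassLinear

noncomputable section

variable {V : Type*} [NormedAddCommGroup V] [NormedSpace ℝ V] {ι : Type*}

/-- `Δ(κ) = ⋂ᵢ {x | ⟨ηᵢ, x⟩ ≤ κᵢ}`. -/
def polytope (η : ι → Module.Dual ℝ V) (κ : ι → ℝ) : Set V :=
  {x | ∀ i, η i x ≤ κ i}

/-- `Fᵢ(κ) = Δ(κ) ∩ {x | ⟨ηᵢ, x⟩ = κᵢ}`. -/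
def facet (η : ι → Module.Dual ℝ V) (κ : ι → ℝ) (i : ι) : Set V :=
  polytope η κ ∩ {x | η i x = κ i}

/-- `Δ(κ)` is a simple polytope whose facets are exactly the `Fᵢ(κ)`: it is bounded, it affinely
spans the ambient space, the affine span of each `Fᵢ` is a hyperplane, and exactly `dim V` of the
facets meet at every vertex. -/
structure IsSimple (η : ι → Module.Dual ℝ V) (κ : ι → ℝ) : Prop where
  bounded : Bornology.IsBounded (polytope η κ)
  affineSpan_eq_top : affineSpan ℝ (polytope η κ) = ⊤
  facet_nonempty : ∀ i, (facet η κ i).Nonempty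
  facet_hyperplane : ∀ i,
    Module.finrank ℝ (affineSpan ℝ (facet η κ i)).direction + 1 = Module.finrank ℝ V
  vertex : ∀ v ∈ (polytope η κ).extremePoints ℝ,
    {i | v ∈ facet η κ i}.ncard = Module.finrank ℝ V

/-- The chamber of `Δ(κ)`: the connected component containing `κ` of the set of all `κ'` for which
`Δ(κ')` is simple. -/
def chamber (η : ι → Module.Dual ℝ V) (κ : ι → ℝ) : Set (ι → ℝ) :=
  connectedComponentIn {κ' | IsSimple η κ'} κ

/-- The center of mass of `Δ(κ)`, where `μ` is a Haar (Lebesgue) measure. -/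
def centerOfMass [MeasurableSpace V] (μ : MeasureTheory.Measure V) (η : ι → Module.Dual ℝ V)
    (κ : ι → ℝ) : V :=
  ⨍ x in polytope η κ, x ∂μ

/-- `H` is mass linear: `κ' ↦ ⟨H, c_Δ(κ')⟩` has the form `∑ γᵢ κ'ᵢ + C` on the chamber. -/
def IsMassLinear [Fintype ι] [MeasurableSpace V] (μ : MeasureTheory.Measure V)
    (η : ι → Module.Dual ℝ V) (κ : ι → ℝ) (H : Module.Dual ℝ V) : Prop :=
  ∃ (γ : ι → ℝ) (C : ℝ), ∀ κ' ∈ chamber η κ,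
    H (centerOfMass μ η κ') = ∑ i, γ i * κ' i + C

/-- `a` is an affine symmetry of `Δ` whose linear part belongs to the set `G` of allowed linear
maps: all linear maps for simple polytopes, lattice automorphisms for smooth ones. -/
def IsSymmetry (G : Set (V →ₗ[ℝ] V)) (Δ : Set V) (a : V →ᵃ[ℝ] V) : Prop :=
  a.linear ∈ G ∧ a '' Δ = Δ

/-- A robust symmetry: a linear map that is the linear part of a symmetry of `Δ(κ')` for every
`κ'` in the chamber. -/
def IsRobustSymmetry (G : Set (V →ₗ[ℝ] V)) (η : ι → Module.Dual ℝ V) (κ : ι → ℝ)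
    (f : V →ₗ[ℝ] V) : Prop :=
  ∀ κ' ∈ chamber η κ, ∃ a : V →ᵃ[ℝ] V, IsSymmetry G (polytope η κ') a ∧ a.linear = f

/-- `Fᵢ ∼ Fⱼ`: some robust symmetry is such that each associated symmetry of `Δ(κ')` takes
`Fᵢ(κ')` to `Fⱼ(κ')`.  (The symmetry of `Δ(κ')` with a given linear part is unique, because
`Δ(κ')` is bounded and nonempty.) -/
def FacetEquiv (G : Set (V →ₗ[ℝ] V)) (η : ι → Module.Dual ℝ V) (κ : ι → ℝ) (i j : ι) : Prop :=
  ∃ f : V →ₗ[ℝ] V, ∀ κ' ∈ chamber η κ, ∃ a : V →ᵃ[ℝ] V,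
    IsSymmetry G (polytope η κ') a ∧ a.linear = f ∧ a '' facet η κ' i = facet η κ' j

/-- The equivalence class of the facet `Fᵢ`, as a set of indices. -/
def facetClass (G : Set (V →ₗ[ℝ] V)) (η : ι → Module.Dual ℝ V) (κ : ι → ℝ) (i : ι) : Set ι :=
  {j | FacetEquiv G η κ i j}

/-- `ζ` is a normalized choice of outward conormals of `Δ(κ)`: each `ζᵢ` is a positive multiple of
`ηᵢ`, and the transpose of every robust symmetry maps each `ζᵢ` to some `ζⱼ`. -/
def IsNormalizedConormals (G : Set (V →ₗ[ℝ] V)) (η : ι → Module.Dual ℝ V) (κ : ι → ℝ)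
    (ζ : ι → Module.Dual ℝ V) : Prop :=
  (∀ i, ∃ c : ℝ, 0 < c ∧ ζ i = c • η i) ∧
    ∀ f, IsRobustSymmetry G η κ f → ∀ i, ∃ j, ζ i ∘ₗ f = ζ j

open Classical in
/-- `H` is inessential: `H = ∑ βᵢ ζᵢ` with `∑_{i ∈ I} βᵢ = 0` for every equivalence class `I` of
facets, where `ζ` is a normalized choice of outward conormals.  The condition does not depend on
this choice: two normalized choices differ by positive factors constant on each class. -/
def IsInessential [Fintype ι] (G : Set (V →ₗ[ℝ] V)) (η : ι → Module.Dual ℝ V) (κ : ι → ℝ)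
    (H : Module.Dual ℝ V) : Prop :=
  ∃ ζ : ι → Module.Dual ℝ V, IsNormalizedConormals G η κ ζ ∧
    ∃ β : ι → ℝ, H = ∑ i, β i • ζ i ∧ ∀ i, ∑ j with j ∈ facetClass G η κ i, β j = 0

/-- The product `∏ⱼ λⱼ Δ_{kⱼ}` of scaled standard simplices, where
`λ Δ_k = {x ∈ ℝᵏ | xᵢ ≥ 0 for all i, ∑ xᵢ ≤ λ}`. -/
def simplexProduct {m : ℕ} (k : Fin m → ℕ) (r : Fin m → ℝ) : Set ((j : Fin m) → Fin (k j) → ℝ) :=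
  {x | ∀ j, (∀ i, 0 ≤ x j i) ∧ ∑ i, x j i ≤ r j}

/-- `Δ` is affinely equivalent to a product of simplices. -/
def IsProductOfSimplices (Δ : Set V) : Prop :=
  ∃ (m : ℕ) (k : Fin m → ℕ) (r : Fin m → ℝ) (e : V ≃ᵃ[ℝ] ((j : Fin m) → Fin (k j) → ℝ)),
    (∀ j, 0 < r j) ∧ e '' Δ = simplexProduct k r

/-! ### The smooth case -/

/-- `ℓ` is an integer lattice in `𝔱`: the integer span of a basis. -/
def IsIntegerLattice (ℓ : Submodule ℤ (Module.Dual ℝ V)) : Prop :=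
  ∃ b : Module.Basis (Fin (Module.finrank ℝ V)) ℝ (Module.Dual ℝ V),
    ℓ = Submodule.span ℤ (Set.range b)

/-- The dual lattice in `V = 𝔱*`. -/
def dualLattice (ℓ : Submodule ℤ (Module.Dual ℝ V)) : Set V :=
  {x | ∀ θ ∈ ℓ, ∃ n : ℤ, θ x = n}

/-- Linear maps of `V = 𝔱*` that induce an automorphism of the integer lattice. -/
def latticeMaps (ℓ : Submodule ℤ (Module.Dual ℝ V)) : Set (V →ₗ[ℝ] V) :=
  {f | f '' dualLattice ℓ = dualLattice ℓ}

/-- A lattice vector is primitive if it is not a positive integer multiple of any other lattice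
vector. -/
def IsPrimitive (ℓ : Submodule ℤ (Module.Dual ℝ V)) (θ : Module.Dual ℝ V) : Prop :=
  θ ∈ ℓ ∧ ∀ n : ℕ, 0 < n → ∀ θ' ∈ ℓ, θ = n • θ' → θ' = θ

/-- `Δ(κ)` is a smooth polytope: it is simple, it is rational, and the primitive outward conormals
`ζᵢ` of the facets meeting at any given vertex form a basis of the lattice. -/
def IsSmooth (ℓ : Submodule ℤ (Module.Dual ℝ V)) (η : ι → Module.Dual ℝ V) (κ : ι → ℝ) : Prop :=
  IsSimple η κ ∧ ∃ ζ : ι → Module.Dual ℝ V,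
    (∀ i, ∃ c : ℝ, 0 < c ∧ ζ i = c • η i) ∧ (∀ i, IsPrimitive ℓ (ζ i)) ∧
    ∀ v ∈ (polytope η κ).extremePoints ℝ,
      LinearIndependent ℤ (fun i : {i // v ∈ facet η κ i} => ζ i) ∧
      Submodule.span ℤ (Set.range fun i : {i // v ∈ facet η κ i} => ζ i) = ℓ

/-- `Δ` is equivalent to a product of simplices by an affine isomorphism whose linear part
identifies the integer lattice of `V` with the standard integer lattice. -/
def IsLatticeProductOfSimplices (ℓ : Submodule ℤ (Module.Dual ℝ V)) (Δ : Set V) : Prop :=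
  ∃ (m : ℕ) (k : Fin m → ℕ) (r : Fin m → ℝ) (e : V ≃ᵃ[ℝ] ((j : Fin m) → Fin (k j) → ℝ)),
    (∀ j, 0 < r j) ∧ e '' Δ = simplexProduct k r ∧
    e.linear '' dualLattice ℓ =
      {x : (j : Fin m) → Fin (k j) → ℝ | ∀ j i, ∃ n : ℤ, x j i = (n : ℝ)}

end

end MassLinear

open MassLinear

/-! The four conditions are linked by the cycle 4 → 2 → 1 → 3 → 4.

4 → 2: rescale each `η i` by the reciprocal of its gap, the slack at the center of mass; symmetries
fix the center, so this choice is normalized. If the inessential functionals did not span, a nonzero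
vector `x` would pair equally with all conormals of each class. Moving from the center along `x`
until the boundary is met, one hits all facets of some class at once, against 4.

2 → 1: normalized slacks at the center of mass agree within a class, so pairing them with
coefficients of class sum zero gives a linear formula for `H` of the center.

1 → 3 is the core. Mass linearity makes the gaps affine in `κ`, with some matrix `a`. Pushing facet
`i` outwards adds a thin sliver, and its first moment shows that log volume has partial derivative
`(1 - a i i) / gap i`. Equality of mixed partials, valid at every point of an open set, forces `gap
i / gap j` to be locally constant whenever `a i j ≠ 0`, so rows `i` and `j` are proportional. Hence
`a i j ≠ 0` is an equivalence relation. Translations put the vectors `(η j x)` in the kernel of `a`,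
and conversely a kernel direction moves `κ` without changing the gaps, so it comes from a
translation. After rescaling by inverse gaps, the relations among the conormals are therefore
exactly "each class sums to zero" (`IsSimplexSplitting`), which is the normal form of a product of
simplices.

3 → 4: facet inequalities are unique up to scale, so a product of simplices yields a splitting.
Transposing two facets of one block is then a robust symmetry, and the rescaled slacks of a block
have a positive constant sum, so they cannot all vanish.

In the smooth case, the lattice bases at the vertices force the rescaling to agree, up to a constant
on each class, with the primitive conormals, so all the maps above respect the lattice. -/

namespace MassLinear

open Filter Topology MeasureTheory

set_option linter.unusedSectionVars false

/-! ### Vertices, interior points and facets of simple polytopes -/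

section Basic

variable {V : Type*} [NormedAddCommGroup V] [NormedSpace ℝ V] [FiniteDimensional ℝ V]
  {ι : Type*} [Finite ι] {η : ι → Module.Dual ℝ V} {κ : ι → ℝ}

theorem continuous_dual (θ : Module.Dual ℝ V) : Continuous θ :=
  LinearMap.continuous_of_finiteDimensional θ

theorem eventually_lt_along (η : ι → Module.Dual ℝ V) (κ : ι → ℝ) (x w : V) :
    ∀ᶠ t in 𝓝 (0 : ℝ), ∀ j, η j x < κ j → η j (x + t • w) < κ j := by
  rw [eventually_all]
  intro j
  by_cases h : η j x < κ j
  · have hc : Continuous fun t : ℝ => η j (x + t • w) := by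
      have := continuous_dual (η j)
      fun_prop
    have : ∀ᶠ t in 𝓝 (0 : ℝ), η j (x + t • w) < κ j :=
      hc.continuousAt.eventually_lt continuousAt_const (by simpa using h)
    exact this.mono fun t ht _ => ht
  · exact Eventually.of_forall fun t ht => absurd ht h

theorem exists_pos_lt_along (η : ι → Module.Dual ℝ V) (κ : ι → ℝ) (x w : V) :
    ∃ t : ℝ, 0 < t ∧ (∀ j, η j x < κ j → η j (x + t • w) < κ j) ∧
      ∀ j, η j x < κ j → η j (x + (-t) • w) < κ j := by
  have h := eventually_lt_along η κ x w
  have h' : ∀ᶠ t in 𝓝 (0 : ℝ), ∀ j, η j x < κ j → η j (x + (-t) • w) < κ j := by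
    have : Tendsto (fun t : ℝ => -t) (𝓝 0) (𝓝 0) := by
      simpa using (continuous_neg (G := ℝ)).tendsto 0
    exact this.eventually h
  have h3 : ∀ᶠ t in 𝓝[>] (0 : ℝ), 0 < t := self_mem_nhdsWithin
  obtain ⟨t, h1, h2, h3⟩ :=
    ((h.filter_mono nhdsWithin_le_nhds).and ((h'.filter_mono nhdsWithin_le_nhds).and h3)).exists
  exact ⟨t, h3, h1, h2⟩

theorem isClosed_polytope (η : ι → Module.Dual ℝ V) (κ : ι → ℝ) : IsClosed (polytope η κ) := by
  have : polytope η κ = ⋂ i, {x | η i x ≤ κ i} := by ext; simp [polytope]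
  rw [this]
  exact isClosed_iInter fun i => isClosed_le (continuous_dual (η i)) continuous_const

theorem IsSimple.isCompact (h : IsSimple η κ) : IsCompact (polytope η κ) :=
  Metric.isCompact_of_isClosed_isBounded (isClosed_polytope η κ) h.bounded

theorem IsSimple.nonempty (h : IsSimple η κ) : (polytope η κ).Nonempty := by
  rw [← affineSpan_nonempty ℝ, h.affineSpan_eq_top]
  exact ⟨0, trivial⟩

/-- A direction killed by all active conormals can be followed both ways for a short time;
conversely, every constraint active inside a segment is active at its endpoints. -/
theorem mem_extremePoints_polytope_iff {x : V} (hx : x ∈ polytope η κ) :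
    x ∈ (polytope η κ).extremePoints ℝ ↔ ∀ w, (∀ i, η i x = κ i → η i w = 0) → w = 0 := by
  constructor
  · intro hext w hw
    obtain ⟨t, ht, h1, h2⟩ := exists_pos_lt_along η κ x w
    have key : ∀ s : ℝ, (∀ j, η j x < κ j → η j (x + s • w) < κ j) → x + s • w ∈ polytope η κ := by
      intro s hs j
      rcases (hx j).lt_or_eq with h | h
      · exact (hs j h).le
      · simp [hw j h, h]
    have hxm : x ∈ openSegment ℝ (x + t • w) (x + (-t) • w) := by
      refine ⟨1 / 2, 1 / 2, by norm_num, by norm_num, by norm_num, ?_⟩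
      module
    have := hext.2 (key t h1) (key (-t) h2) hxm
    have h0 : t • w = 0 := by simpa using this
    exact (smul_eq_zero.1 h0).resolve_left ht.ne'
  · intro h
    refine ⟨hx, ?_⟩
    rintro y hy z hz ⟨a, b, ha, hb, hab, rfl⟩
    have : y - z = 0 := by
      apply h
      intro i hi
      simp only [map_add, map_smul, smul_eq_mul] at hi
      have h1 := hy i
      have h2 := hz i
      have e1 : η i y = κ i := by
        by_contra hne
        have := mul_lt_mul_of_pos_left (lt_of_le_of_ne h1 hne) ha
        have := mul_le_mul_of_nonneg_left h2 hb.le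
        have : a * κ i + b * κ i = κ i := by rw [← add_mul, hab, one_mul]
        linarith
      have e2 : η i z = κ i := by
        rw [e1] at hi
        have : a * κ i + b * κ i = κ i := by rw [← add_mul, hab, one_mul]
        have : b * η i z = b * κ i := by linarith
        exact mul_left_cancel₀ hb.ne' this
      rw [map_sub, e1, e2, sub_self]
    have hyz : y = z := sub_eq_zero.1 this
    subst hyz
    rw [← add_smul, hab, one_smul]

/-- At a vertex of a simple polytope the active conormals take arbitrary prescribed values. -/
theorem IsSimple.exists_apply_eq (h : IsSimple η κ) {v : V}
    (hv : v ∈ (polytope η κ).extremePoints ℝ) (y : ι → ℝ) :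
    ∃ w, ∀ i, η i v = κ i → η i w = y i := by
  classical
  have := Fintype.ofFinite ι
  let A := {i // v ∈ facet η κ i}
  let L : V →ₗ[ℝ] (A → ℝ) := LinearMap.pi fun i => η i.1
  have hinj : Function.Injective L := by
    rw [← LinearMap.ker_eq_bot, LinearMap.ker_eq_bot']
    intro w hw
    refine (mem_extremePoints_polytope_iff hv.1).1 hv w fun i hi => ?_
    exact congrFun hw ⟨i, hv.1, hi⟩
  -- Simplicity makes the number of active facets equal to the dimension, so injectivity gives
  -- surjectivity.
  have hcard : Module.finrank ℝ V = Module.finrank ℝ (A → ℝ) := by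
    rw [Module.finrank_fintype_fun_eq_card, ← h.vertex v hv, ← Nat.card_coe_set_eq,
      Nat.card_eq_fintype_card]
    rfl
  obtain ⟨w, hw⟩ := ((LinearMap.injective_iff_surjective_of_finrank_eq_finrank hcard).1 hinj)
    fun i => y i.1
  exact ⟨w, fun i hi => congrFun hw ⟨i, hv.1, hi⟩⟩

theorem IsSimple.exists_vertex (h : IsSimple η κ) :
    ∃ v, v ∈ (polytope η κ).extremePoints ℝ :=
  h.isCompact.extremePoints_nonempty h.nonempty

/-- Leave a vertex in a direction along which every active conormal decreases. -/
theorem IsSimple.exists_interior (h : IsSimple η κ) : ∃ q, ∀ i, η i q < κ i := by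
  obtain ⟨v, hv⟩ := h.exists_vertex
  obtain ⟨w, hw⟩ := h.exists_apply_eq hv fun _ => -1
  obtain ⟨t, ht, h1, -⟩ := exists_pos_lt_along η κ v w
  refine ⟨v + t • w, fun i => ?_⟩
  rcases (hv.1 i).lt_or_eq with hi | hi
  · exact h1 i hi
  · simp [hw i hi, hi, ht]

theorem IsSimple.exists_vertex_mem_facet (h : IsSimple η κ) (i : ι) :
    ∃ v ∈ (polytope η κ).extremePoints ℝ, η i v = κ i := by
  have hF : IsCompact (facet η κ i) :=
    h.isCompact.inter_right (isClosed_eq (continuous_dual (η i)) continuous_const)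
  obtain ⟨v, hv⟩ := hF.extremePoints_nonempty (h.facet_nonempty i)
  have hex : IsExtreme ℝ (polytope η κ) (facet η κ i) := by
    refine ⟨fun x hx => hx.1, ?_⟩
    rintro x hx y hy z ⟨hz, hzi⟩ ⟨a, b, ha, hb, hab, rfl⟩
    refine ⟨hx, ?_⟩
    simp only [Set.mem_ofPred_eq, map_add, map_smul, smul_eq_mul] at hzi ⊢
    by_contra hne
    have := mul_lt_mul_of_pos_left (lt_of_le_of_ne (hx i) hne) ha
    have := mul_le_mul_of_nonneg_left (hy i) hb.le
    have : a * κ i + b * κ i = κ i := by rw [← add_mul, hab, one_mul]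
    linarith
  exact ⟨v, hex.extremePoints_subset_extremePoints hv, hv.1.2⟩

/-- Every facet of a simple polytope contains a point lying on no other facet. -/
theorem IsSimple.exists_relint (h : IsSimple η κ) (i : ι) :
    ∃ p, η i p = κ i ∧ ∀ j, j ≠ i → η j p < κ j := by
  classical
  obtain ⟨v, hv, hvi⟩ := h.exists_vertex_mem_facet i
  obtain ⟨w, hw⟩ := h.exists_apply_eq hv fun j => if j = i then 0 else -1
  obtain ⟨t, ht, h1, -⟩ := exists_pos_lt_along η κ v w
  refine ⟨v + t • w, ?_, fun j hj => ?_⟩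
  · simp [hw i hvi, hvi]
  · rcases (hv.1 j).lt_or_eq with hj' | hj'
    · exact h1 j hj'
    · simp [hw j hj', hj', hj, ht]

theorem IsSimple.exists_apply_eq_one (h : IsSimple η κ) (i : ι) : ∃ w, η i w = 1 := by
  obtain ⟨v, hv, hvi⟩ := h.exists_vertex_mem_facet i
  obtain ⟨w, hw⟩ := h.exists_apply_eq hv fun _ => 1
  exact ⟨w, hw i hvi⟩

/-- With `q` strictly inside `Δ(κ)`, a homothety of `Δ(κ)` about `q` with large enough factor `l`
contains `Δ(κ')`. -/
theorem isBounded_polytope_of_interior (hb : Bornology.IsBounded (polytope η κ)) {q : V}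
    (hq : ∀ i, η i q < κ i) (κ' : ι → ℝ) : Bornology.IsBounded (polytope η κ') := by
  have := Fintype.ofFinite ι
  obtain ⟨R, hR⟩ := hb.exists_norm_le
  set l : ℝ := 1 + ∑ i, |(κ' i - η i q) / (κ i - η i q)| with hl
  have hl0 : 0 < l := by positivity
  have hle : ∀ i, κ' i - η i q ≤ l * (κ i - η i q) := by
    intro i
    have h1 : |(κ' i - η i q) / (κ i - η i q)| ≤ l := by
      have := Finset.single_le_sum (f := fun i => |(κ' i - η i q) / (κ i - η i q)|)
        (fun j _ => abs_nonneg _) (Finset.mem_univ i)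
      linarith
    have h2 := (le_abs_self _).trans h1
    rwa [div_le_iff₀ (sub_pos.2 (hq i))] at h2
  rw [isBounded_iff_forall_norm_le]
  refine ⟨‖q‖ + l * (R + ‖q‖), fun x hx => ?_⟩
  have hy : q + l⁻¹ • (x - q) ∈ polytope η κ := by
    intro i
    have h1 : η i x - η i q ≤ l * (κ i - η i q) := (sub_le_sub_right (hx i) _).trans (hle i)
    have h2 : l⁻¹ * (η i x - η i q) ≤ κ i - η i q := by
      rwa [inv_mul_le_iff₀ hl0]
    simp only [map_add, map_smul, map_sub, smul_eq_mul]
    linarith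
  have h3 := hR _ hy
  have h4 : x = q + l • ((q + l⁻¹ • (x - q)) - q) := by
    rw [add_sub_cancel_left, smul_smul, mul_inv_cancel₀ hl0.ne', one_smul, add_sub_cancel]
  rw [h4]
  refine (norm_add_le _ _).trans ?_
  rw [norm_smul, Real.norm_of_nonneg hl0.le]
  have h5 := (norm_sub_le (q + l⁻¹ • (x - q)) q).trans (add_le_add_left h3 ‖q‖)
  gcongr

theorem isOpen_interior_polytope (η : ι → Module.Dual ℝ V) (κ : ι → ℝ) :
    IsOpen {x | ∀ i, η i x < κ i} := by
  have : {x | ∀ i, η i x < κ i} = ⋂ i, {x | η i x < κ i} := by ext; simp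
  rw [this]
  exact isOpen_iInter_of_finite fun i => isOpen_lt (continuous_dual (η i)) continuous_const

theorem affineSpan_polytope_eq_top {q : V} (hq : ∀ i, η i q < κ i) :
    affineSpan ℝ (polytope η κ) = ⊤ := by
  have h : {x | ∀ i, η i x < κ i} ⊆ polytope η κ := fun x hx i => (hx i).le
  exact top_le_iff.1 (((isOpen_interior_polytope η κ).affineSpan_eq_top ⟨q, hq⟩).ge.trans
    (affineSpan_mono ℝ h))

theorem finrank_direction_facet {i : ι} {p : V} (hi : η i p = κ i)
    (hj : ∀ j, j ≠ i → η j p < κ j) (h0 : η i ≠ 0) :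
    Module.finrank ℝ (affineSpan ℝ (facet η κ i)).direction + 1 = Module.finrank ℝ V := by
  have : (affineSpan ℝ (facet η κ i)).direction = LinearMap.ker (η i) := by
    rw [direction_affineSpan]
    apply le_antisymm
    · rw [vectorSpan, Submodule.span_le]
      rintro _ ⟨x, hx, y, hy, rfl⟩
      simp [hx.2.out, hy.2.out]
    · intro w hw
      rw [LinearMap.mem_ker] at hw
      obtain ⟨t, ht, h1, -⟩ := exists_pos_lt_along η κ p w
      have hmem : ∀ s : ℝ, (∀ j, η j p < κ j → η j (p + s • w) < κ j) →
          p + s • w ∈ facet η κ i := by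
        intro s hs
        have hh : η i (p + s • w) = κ i := by simp [hw, hi]
        refine ⟨fun j => ?_, hh⟩
        by_cases hji : j = i
        · subst hji; exact hh.le
        · exact (hs j (hj j hji)).le
      have h2 := vsub_mem_vectorSpan ℝ (hmem t h1) (hmem 0 (by simp))
      have h3 : t • w ∈ vectorSpan ℝ (facet η κ i) := by simpa using h2
      simpa [smul_smul, inv_mul_cancel₀ ht.ne'] using
        Submodule.smul_mem _ t⁻¹ h3
  rw [this]
  exact Module.Dual.finrank_ker_add_one_of_ne_zero h0

end Basic

/-! ### Simplicity is an open condition on the support numbers -/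

section Openness

variable {V : Type*} [NormedAddCommGroup V] [NormedSpace ℝ V] [FiniteDimensional ℝ V]
  {ι : Type*} [Fintype ι] {η : ι → Module.Dual ℝ V} {κ : ι → ℝ}

/-- The support numbers for which some point of the polytope lies on all facets in `A` form a closed
set, provided that the conormals in `A` separate points. -/
theorem isClosed_setOf_common_point (A : Set ι) (hA : ∀ w : V, (∀ i ∈ A, η i w = 0) → w = 0) :
    IsClosed {κ' : ι → ℝ | ∃ x ∈ polytope η κ', ∀ i ∈ A, η i x = κ' i} := by
  let L : V →ₗ[ℝ] (A → ℝ) := LinearMap.pi fun i => η i.1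
  have hker : LinearMap.ker L = ⊥ := by
    rw [LinearMap.ker_eq_bot']
    exact fun w hw => hA w fun i hi => congrFun hw ⟨i, hi⟩
  obtain ⟨g, hg⟩ := L.exists_leftInverse_of_injective hker
  have hgc : Continuous g := LinearMap.continuous_of_finiteDimensional g
  have hgL : ∀ x, g (L x) = x := fun x => congrArg (fun f => f x) hg
  let r : (ι → ℝ) → V := fun κ' => g fun i => κ' i.1
  have hr : Continuous r := hgc.comp (by fun_prop)
  have hset : {κ' : ι → ℝ | ∃ x ∈ polytope η κ', ∀ i ∈ A, η i x = κ' i} =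
      {κ' | ∀ i, η i (r κ') ≤ κ' i} ∩ {κ' | ∀ i ∈ A, η i (r κ') = κ' i} := by
    ext κ'
    constructor
    · rintro ⟨x, hx, hxA⟩
      have : r κ' = x := by
        have h1 : (fun i : A => κ' i.1) = L x := funext fun i => (hxA i.1 i.2).symm
        change g (fun i : A => κ' i.1) = x
        rw [h1, hgL]
      refine ⟨fun i => ?_, fun i hi => ?_⟩
      · rw [this]; exact hx i
      · rw [this]; exact hxA i hi
    · rintro ⟨h1, h2⟩
      exact ⟨r κ', h1, h2⟩
  rw [hset]
  have hc : ∀ i, Continuous fun κ' => η i (r κ') := fun i => (continuous_dual (η i)).comp hr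
  refine IsClosed.inter ?_ ?_
  · simp only [Set.ofPred_forall]
    exact isClosed_iInter fun i => isClosed_le (hc i) (continuous_apply i)
  · simp only [Set.ofPred_forall]
    exact isClosed_iInter fun i => isClosed_iInter fun _ => isClosed_eq (hc i) (continuous_apply i)

/-- Interior and relative interior points persist under small changes of `κ`. The vertex condition
persists because there are finitely many candidate active sets, and each one of the wrong size is
excluded by a closed condition. -/
theorem IsSimple.eventually (h : IsSimple η κ) : ∀ᶠ κ' in 𝓝 κ, IsSimple η κ' := by
  obtain ⟨q, hq⟩ := h.exists_interior
  have e1 : ∀ᶠ κ' in 𝓝 κ, ∀ i, η i q < κ' i := by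
    rw [eventually_all]
    exact fun i => continuousAt_const.eventually_lt (continuous_apply i).continuousAt (hq i)
  choose p hp hpj using h.exists_relint
  choose w hw using h.exists_apply_eq_one
  have e2 : ∀ᶠ κ' in 𝓝 κ, ∀ i j, j ≠ i → η j (p i + (κ' i - κ i) • w i) < κ' j := by
    rw [eventually_all]
    intro i
    rw [eventually_all]
    intro j
    by_cases hji : j = i
    · exact Eventually.of_forall fun _ hne => absurd hji hne
    · have hc : Continuous fun κ' : ι → ℝ => η j (p i + (κ' i - κ i) • w i) := by
        have := continuous_dual (η j)
        fun_prop
      have : ∀ᶠ κ' in 𝓝 κ, η j (p i + (κ' i - κ i) • w i) < κ' j :=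
        hc.continuousAt.eventually_lt (continuous_apply j).continuousAt
          (by simpa using hpj i j hji)
      exact this.mono fun _ hx _ => hx
  have e3 : ∀ᶠ κ' in 𝓝 κ, ∀ A : Set ι, (∀ w : V, (∀ i ∈ A, η i w = 0) → w = 0) →
      A.ncard ≠ Module.finrank ℝ V →
      ¬ ∃ x ∈ polytope η κ', ∀ i, η i x = κ' i ↔ i ∈ A := by
    rw [eventually_all]
    intro A
    by_cases hA : ∀ w : V, (∀ i ∈ A, η i w = 0) → w = 0
    swap
    · exact Eventually.of_forall fun _ h' => absurd h' hA
    by_cases hc : A.ncard = Module.finrank ℝ V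
    · exact Eventually.of_forall fun _ _ h' => absurd hc h'
    by_cases hlt : ∃ x ∈ polytope η κ, ∀ i ∈ A, η i x = κ i
    · obtain ⟨x, hx, hxA⟩ := hlt
      have hext : x ∈ (polytope η κ).extremePoints ℝ :=
        (mem_extremePoints_polytope_iff hx).2 fun w hw' => hA w fun i hi => hw' i (hxA i hi)
      have hcard := h.vertex x hext
      have hss : A ⊂ {i | x ∈ facet η κ i} := by
        refine lt_of_le_of_ne (fun i hi => ⟨hx, hxA i hi⟩) ?_
        rintro rfl
        exact hc hcard
      have hn := Set.ncard_lt_ncard hss (Set.toFinite _)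
      exfalso
      obtain ⟨i, hi, hiA⟩ := Set.exists_of_ssubset hss
      classical
      -- An active facet `i` outside `A` would allow a vector killed by `A` but not by `η i`,
      -- although `A` separates points.
      obtain ⟨y, hy⟩ := h.exists_apply_eq hext fun k => if k = i then 1 else 0
      have hy0 : y = 0 := hA y fun k hk => by
        rw [hy k (hxA k hk), if_neg]
        rintro rfl
        exact hiA hk
      have := hy i hi.2
      simp [hy0] at this
    · have := (isClosed_setOf_common_point A hA).isOpen_compl.mem_nhds hlt
      filter_upwards [this] with κ' hκ' _ _
      rintro ⟨x, hx, hxA⟩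
      exact hκ' ⟨x, hx, fun i hi => (hxA i).2 hi⟩
  filter_upwards [e1, e2, e3] with κ' h1 h2 h3
  have hface : ∀ i, η i (p i + (κ' i - κ i) • w i) = κ' i := fun i => by simp [hp, hw]
  refine ⟨isBounded_polytope_of_interior h.bounded hq κ', affineSpan_polytope_eq_top h1, ?_, ?_, ?_⟩
  · intro i
    refine ⟨p i + (κ' i - κ i) • w i, fun j => ?_, hface i⟩
    by_cases hji : j = i
    · subst hji; exact (hface j).le
    · exact (h2 i j hji).le
  · intro i
    refine finrank_direction_facet (hface i) (h2 i) ?_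
    intro h0
    have := hw i
    simp [h0] at this
  · intro v hv
    by_contra hne
    refine h3 {i | v ∈ facet η κ' i} (fun w hw' => ?_) hne ⟨v, hv.1, fun i => ?_⟩
    · exact (mem_extremePoints_polytope_iff hv.1).1 hv w fun i hi => hw' i ⟨hv.1, hi⟩
    · exact ⟨fun hi => ⟨hv.1, hi⟩, fun hi => hi.2⟩

theorem IsSimple.exists_ball_subset_chamber (h : IsSimple η κ) :
    ∃ ε > 0, Metric.ball κ ε ⊆ chamber η κ := by
  obtain ⟨ε, hε, hball⟩ := Metric.eventually_nhds_iff_ball.1 h.eventually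
  exact ⟨ε, hε, (convex_ball κ ε).isPreconnected.subset_connectedComponentIn
    (Metric.mem_ball_self hε) hball⟩

theorem IsSimple.mem_chamber (h : IsSimple η κ) : κ ∈ chamber η κ :=
  mem_connectedComponentIn h

theorem isSimple_of_mem_chamber {κ' : ι → ℝ} (h : κ' ∈ chamber η κ) : IsSimple η κ' :=
  connectedComponentIn_subset _ _ h

end Openness

/-- The distance, measured by `ηᵢ`, from the center of mass of `Δ(κ)` to the facet `Fᵢ`. -/
noncomputable def gap {V : Type*} [NormedAddCommGroup V] [NormedSpace ℝ V] [MeasurableSpace V]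
    (μ : MeasureTheory.Measure V) {ι : Type*} (η : ι → Module.Dual ℝ V) (κ : ι → ℝ) (i : ι) : ℝ :=
  κ i - η i (centerOfMass μ η κ)

/-! ### Center of mass under affine maps, translation and scaling -/

section CenterOfMass

variable {V : Type*} [NormedAddCommGroup V] [NormedSpace ℝ V] [FiniteDimensional ℝ V]
  [MeasurableSpace V] [BorelSpace V] (μ : Measure V) [μ.IsAddHaarMeasure]
  {ι : Type*} [Fintype ι] {η : ι → Module.Dual ℝ V} {κ : ι → ℝ}

/-- By change of variables, the constant Jacobian multiplies both the integral and the volume and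
cancels in the average. -/
theorem setAverage_image_affine {P : Set V} (hP : MeasurableSet P) (hP0 : μ P ≠ 0)
    (hPt : μ P ≠ ⊤) (hint : IntegrableOn (fun x => x) P μ) (a : V →ᵃ[ℝ] V)
    (ha : Function.Injective a) :
    ⨍ x in a '' P, x ∂μ = a (⨍ x in P, x ∂μ) := by
  let A : V →L[ℝ] V := LinearMap.toContinuousLinearMap a.linear
  have hd : ∀ x ∈ P, HasFDerivWithinAt a A P x := by
    intro x _
    have h1 : (a : V → V) = fun x => A x + a 0 := by
      funext x
      exact congrFun (AffineMap.decomp a) x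
    rw [h1]
    exact (A.hasFDerivAt.add_const (a 0)).hasFDerivWithinAt
  have hfin : IsFiniteMeasure (μ.restrict P) := ⟨by simpa only [Measure.restrict_apply_univ] using hPt.lt_top⟩
  have hne : μ.real P ≠ 0 := by
    rw [Measure.real, ENNReal.toReal_ne_zero]; exact ⟨hP0, hPt⟩
  have hlin : Function.Injective a.linear := (AffineMap.linear_injective_iff a).2 ha
  have hdet : |A.det| ≠ 0 := by
    rw [abs_ne_zero]
    have : IsUnit (LinearMap.det a.linear) :=
      (LinearMap.isUnit_iff_isUnit_det _).1 ((Module.End.isUnit_iff _).2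
        ⟨hlin, (LinearMap.injective_iff_surjective).1 hlin⟩)
    exact this.ne_zero
  have hvol : μ.real (a '' P) = |A.det| * μ.real P := by
    have := integral_image_eq_integral_abs_det_fderiv_smul μ hP hd ha.injOn (fun _ => (1 : ℝ))
    simp only [integral_const, measureReal_restrict_apply_univ, smul_eq_mul, mul_one] at this
    rw [this, mul_comm]
  rw [setAverage_eq, setAverage_eq, hvol,
    integral_image_eq_integral_abs_det_fderiv_smul μ hP hd ha.injOn, integral_smul,
    mul_inv, smul_smul, mul_right_comm, inv_mul_cancel₀ hdet, one_mul]
  have h2 : ∫ x in P, a x ∂μ = A (∫ x in P, x ∂μ) + μ.real P • a 0 := by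
    rw [← A.integral_comp_comm hint]
    have : ∀ x, a x = A x + a 0 := fun x => congrFun (AffineMap.decomp a) x
    rw [integral_congr_ae (Eventually.of_forall this),
      integral_add (A.integrable_comp hint) (integrable_const _), integral_const,
      measureReal_restrict_apply_univ]
  rw [h2, smul_add, smul_smul, inv_mul_cancel₀ hne, one_smul, ← map_smul]
  exact (congrFun (AffineMap.decomp a) _).symm

theorem IsSimple.measure_pos (h : IsSimple η κ) : 0 < μ (polytope η κ) := by
  obtain ⟨q, hq⟩ := h.exists_interior
  exact ((isOpen_interior_polytope η κ).measure_pos μ ⟨q, hq⟩).trans_le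
    (measure_mono fun x hx i => (hx i).le)

theorem IsSimple.measure_lt_top (h : IsSimple η κ) : μ (polytope η κ) < ⊤ :=
  h.isCompact.measure_lt_top

theorem IsSimple.measureReal_pos (h : IsSimple η κ) : 0 < μ.real (polytope η κ) :=
  ENNReal.toReal_pos (h.measure_pos μ).ne' (h.measure_lt_top μ).ne

theorem IsSimple.integrableOn (h : IsSimple η κ) {E : Type*} [NormedAddCommGroup E] {f : V → E}
    (hf : Continuous f) : IntegrableOn f (polytope η κ) μ :=
  hf.continuousOn.integrableOn_compact h.isCompact

theorem IsSimple.integral_apply (h : IsSimple η κ) (θ : Module.Dual ℝ V) :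
    ∫ x in polytope η κ, θ x ∂μ = μ.real (polytope η κ) * θ (centerOfMass μ η κ) := by
  let A : V →L[ℝ] ℝ := LinearMap.toContinuousLinearMap θ
  have h1 := A.integral_comp_comm (h.integrableOn μ continuous_id)
  change ∫ x in polytope η κ, θ x ∂μ = θ (∫ x in polytope η κ, x ∂μ) at h1
  rw [h1, centerOfMass, setAverage_eq, map_smul, smul_eq_mul, ← mul_assoc,
    mul_inv_cancel₀ (h.measureReal_pos μ).ne', one_mul]

theorem IsSimple.centerOfMass_lt (h : IsSimple η κ) (i : ι) :
    η i (centerOfMass μ η κ) < κ i := by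
  have hv := h.measureReal_pos μ
  have hfin : IsFiniteMeasure (μ.restrict (polytope η κ)) := ⟨by simpa using h.measure_lt_top μ⟩
  have hc := continuous_dual (η i)
  have hint : IntegrableOn (fun x => κ i - η i x) (polytope η κ) μ :=
    h.integrableOn μ (by fun_prop)
  have hpos : 0 < ∫ x in polytope η κ, (κ i - η i x) ∂μ := by
    rw [setIntegral_pos_iff_support_of_nonneg_ae _ hint]
    · obtain ⟨q, hq⟩ := h.exists_interior
      refine ((isOpen_interior_polytope η κ).measure_pos μ ⟨q, hq⟩).trans_le (measure_mono ?_)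
      intro x hx
      exact ⟨(sub_pos.2 (hx i)).ne', fun j => (hx j).le⟩
    · refine (ae_restrict_iff' (isClosed_polytope η κ).measurableSet).2 (Eventually.of_forall ?_)
      exact fun x hx => sub_nonneg.2 (hx i)
  rw [integral_sub (integrable_const _) (h.integrableOn μ hc), h.integral_apply μ] at hpos
  simp only [integral_const, measureReal_restrict_apply_univ, smul_eq_mul] at hpos
  rw [← mul_sub] at hpos
  exact sub_pos.1 (pos_of_mul_pos_right hpos hv.le)

theorem IsSimple.gap_pos (h : IsSimple η κ) (i : ι) : 0 < gap μ η κ i :=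
  sub_pos.2 (h.centerOfMass_lt μ i)

theorem IsSimple.centerOfMass_of_image (h : IsSimple η κ) {κ' : ι → ℝ} (a : V →ᵃ[ℝ] V)
    (ha : Function.Injective a) (himg : a '' polytope η κ = polytope η κ') :
    centerOfMass μ η κ' = a (centerOfMass μ η κ) := by
  rw [centerOfMass, centerOfMass, ← himg]
  exact setAverage_image_affine μ (isClosed_polytope η κ).measurableSet (h.measure_pos μ).ne'
    (h.measure_lt_top μ).ne (h.integrableOn μ continuous_id) a ha

theorem IsSimple.centerOfMass_translate (h : IsSimple η κ) (x : V) :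
    centerOfMass μ η (fun i => κ i + η i x) = centerOfMass μ η κ + x := by
  refine h.centerOfMass_of_image μ (AffineMap.id ℝ V + AffineMap.const ℝ V x)
    (fun y z hyz => by simpa using hyz) ?_
  ext y
  constructor
  · rintro ⟨z, hz, rfl⟩ i
    simpa using hz i
  · intro hy
    refine ⟨y - x, fun i => ?_, by simp⟩
    have := hy i
    simp only [map_sub]
    linarith

theorem IsSimple.centerOfMass_smul (h : IsSimple η κ) {r : ℝ} (hr : 0 < r) :
    centerOfMass μ η (r • κ) = r • centerOfMass μ η κ := by
  refine h.centerOfMass_of_image μ (r • AffineMap.id ℝ V)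
    (fun y z hyz => by simpa [hr.ne'] using hyz) ?_
  ext y
  constructor
  · rintro ⟨z, hz, rfl⟩ i
    simpa using mul_le_mul_of_nonneg_left (hz i) hr.le
  · intro hy
    refine ⟨r⁻¹ • y, fun i => ?_, by simp [hr.ne']⟩
    have := hy i
    simp only [Pi.smul_apply, smul_eq_mul] at this
    simpa [inv_mul_le_iff₀ hr] using this

end CenterOfMass

/-! ### One-variable and two-variable calculus -/

section Analysis

/-- A squeeze for the slope. The bounds are phrased by left and right endpoint of the interval; `min
t s` and `max t s` treat both sides of `t` together. -/
theorem hasDerivAt_of_slope_bounds {F h : ℝ → ℝ} {α t : ℝ} (hh : ContinuousAt h t) (ht : 0 < h t)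
    (hright : ∀ᶠ s in 𝓝 t, t < s → α * (s - t) / (h t + (s - t)) ≤ F s - F t ∧
      F s - F t ≤ α * (s - t) / (h s - (s - t)))
    (hleft : ∀ᶠ s in 𝓝 t, s < t → α * (t - s) / (h s + (t - s)) ≤ F t - F s ∧
      F t - F s ≤ α * (t - s) / (h t - (t - s))) :
    HasDerivAt F (α / h t) t := by
  have hmin : ContinuousAt (fun s => min t s) t := by fun_prop
  have hmax : ContinuousAt (fun s => max t s) t := by fun_prop
  have hhmin : ContinuousAt (fun s => h (min t s)) t :=
    ContinuousAt.comp (g := h) (f := fun s => min t s) (by simpa using hh) hmin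
  have hhmax : ContinuousAt (fun s => h (max t s)) t :=
    ContinuousAt.comp (g := h) (f := fun s => max t s) (by simpa using hh) hmax
  have hl : ContinuousAt (fun s => α / (h (min t s) + |s - t|)) t :=
    continuousAt_const.div (hhmin.add (by fun_prop)) (by simpa using ht.ne')
  have hu : ContinuousAt (fun s => α / (h (max t s) - |s - t|)) t :=
    continuousAt_const.div (hhmax.sub (by fun_prop)) (by simpa using ht.ne')
  have hl' : Tendsto (fun s => α / (h (min t s) + |s - t|)) (𝓝[≠] t) (𝓝 (α / h t)) := by
    simpa using hl.tendsto.mono_left nhdsWithin_le_nhds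
  have hu' : Tendsto (fun s => α / (h (max t s) - |s - t|)) (𝓝[≠] t) (𝓝 (α / h t)) := by
    simpa using hu.tendsto.mono_left nhdsWithin_le_nhds
  rw [hasDerivAt_iff_tendsto_slope]
  have key : ∀ᶠ s in 𝓝[≠] t, α / (h (min t s) + |s - t|) ≤ slope F t s ∧
      slope F t s ≤ α / (h (max t s) - |s - t|) := by
    filter_upwards [hright.filter_mono nhdsWithin_le_nhds, hleft.filter_mono nhdsWithin_le_nhds,
      self_mem_nhdsWithin] with s h1 h2 hne
    rcases lt_or_gt_of_ne (Set.mem_compl_singleton_iff.1 hne) with hlt | hgt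
    · obtain ⟨h3, h4⟩ := h2 hlt
      have hp : 0 < t - s := sub_pos.2 hlt
      rw [min_eq_right hlt.le, max_eq_left hlt.le, abs_of_neg (by linarith), slope_comm,
        slope_def_field, neg_sub, le_div_iff₀ hp, div_le_iff₀ hp, div_mul_eq_mul_div,
        div_mul_eq_mul_div]
      exact ⟨h3, h4⟩
    · obtain ⟨h3, h4⟩ := h1 hgt
      have hp : 0 < s - t := sub_pos.2 hgt
      rw [min_eq_left hgt.le, max_eq_right hgt.le, abs_of_pos (by linarith),
        slope_def_field, le_div_iff₀ hp, div_le_iff₀ hp, div_mul_eq_mul_div,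
        div_mul_eq_mul_div]
      exact ⟨h3, h4⟩
  exact tendsto_of_tendsto_of_tendsto_of_le_of_le' hl' hu' (key.mono fun _ h => h.1)
    (key.mono fun _ h => h.2)

/-- Equality of mixed second derivatives for a function whose partial derivatives are inverses of
affine functions. -/
theorem mixed_deriv_eq {F : ℝ → ℝ → ℝ} {ε α β a b c a' b' c' : ℝ} (hε : 0 < ε)
    (hpos : ∀ s t, |s| < ε → |t| < ε → 0 < a + b * s + c * t ∧ 0 < a' + b' * s + c' * t)
    (h1 : ∀ s t, |s| < ε → |t| < ε → HasDerivAt (fun s => F s t) (α / (a + b * s + c * t)) s)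
    (h2 : ∀ s t, |s| < ε → |t| < ε → HasDerivAt (fun t => F s t) (β / (a' + b' * s + c' * t)) t) :
    α * c * a' ^ 2 = β * b' * a ^ 2 := by
  have key : ∀ x, ∃ p : ℝ × ℝ, 0 < x → x < ε → (0 < p.1 ∧ p.1 < x) ∧ (0 < p.2 ∧ p.2 < x) ∧
      α * c * ((a' + b' * x + c' * p.2) * (a' + c' * p.2)) =
        β * b' * ((a + b * p.1 + c * x) * (a + b * p.1)) := by
    intro x
    by_cases hx : 0 < x ∧ x < ε
    swap
    · exact ⟨0, fun h3 h4 => absurd ⟨h3, h4⟩ hx⟩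
    obtain ⟨hx0, hxε⟩ := hx
    have hb : ∀ s ∈ Set.Icc 0 x, |s| < ε := fun s hs => by
      rw [abs_of_nonneg hs.1]; exact hs.2.trans_lt hxε
    have hx' : |x| < ε := hb x ⟨hx0.le, le_rfl⟩
    have h0' : |(0 : ℝ)| < ε := by simpa using hε
    -- The mean value theorem, applied to the second difference of `F` on the square `[0, x]²` in
    -- both orders; no second derivatives are needed.
    obtain ⟨p, hp, hpe⟩ := exists_hasDerivAt_eq_slope (fun s => F s x - F s 0)
      (fun s => α / (a + b * s + c * x) - α / (a + b * s + c * 0)) hx0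
      (fun s hs => ((h1 s x (hb s hs) hx').sub (h1 s 0 (hb s hs) h0')).continuousAt.continuousWithinAt)
      (fun s hs => (h1 s x (hb s ⟨hs.1.le, hs.2.le⟩) hx').sub (h1 s 0 (hb s ⟨hs.1.le, hs.2.le⟩) h0'))
    obtain ⟨q, hq, hqe⟩ := exists_hasDerivAt_eq_slope (fun t => F x t - F 0 t)
      (fun t => β / (a' + b' * x + c' * t) - β / (a' + b' * 0 + c' * t)) hx0
      (fun t ht => ((h2 x t hx' (hb t ht)).sub (h2 0 t h0' (hb t ht))).continuousAt.continuousWithinAt)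
      (fun t ht => (h2 x t hx' (hb t ⟨ht.1.le, ht.2.le⟩)).sub (h2 0 t h0' (hb t ⟨ht.1.le, ht.2.le⟩)))
    refine ⟨(p, q), fun _ _ => ⟨hp, hq, ?_⟩⟩
    have hp' := hb p ⟨hp.1.le, hp.2.le⟩
    have hq' := hb q ⟨hq.1.le, hq.2.le⟩
    have e1 := (hpos p x hp' hx').1.ne'
    have e2 := (hpos p 0 hp' h0').1.ne'
    have e3 := (hpos x q hx' hq').2.ne'
    have e4 := (hpos 0 q h0' hq').2.ne'
    have e5 : α / (a + b * p + c * x) - α / (a + b * p + c * 0) =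
        β / (a' + b' * x + c' * q) - β / (a' + b' * 0 + c' * q) := by
      rw [hpe, hqe]; congr 1; ring
    rw [div_sub_div _ _ e1 e2, div_sub_div _ _ e3 e4,
      div_eq_div_iff (mul_ne_zero e1 e2) (mul_ne_zero e3 e4)] at e5
    -- Both differences of reciprocals carry a factor `x`; cancelling it leaves an identity that
    -- survives the limit `x → 0`.
    apply mul_left_cancel₀ hx0.ne'
    linear_combination -e5
  choose p hp using key
  have hev : ∀ᶠ x in 𝓝[>] (0 : ℝ), 0 < x ∧ x < ε :=
    Ioo_mem_nhdsGT hε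
  have hid : Tendsto (fun x : ℝ => x) (𝓝[>] 0) (𝓝 0) := tendsto_id.mono_left nhdsWithin_le_nhds
  have t1 : Tendsto (fun x => (p x).1) (𝓝[>] 0) (𝓝 0) :=
    tendsto_of_tendsto_of_tendsto_of_le_of_le' tendsto_const_nhds hid
      (hev.mono fun x hx => (hp x hx.1 hx.2).1.1.le) (hev.mono fun x hx => (hp x hx.1 hx.2).1.2.le)
  have t2 : Tendsto (fun x => (p x).2) (𝓝[>] 0) (𝓝 0) :=
    tendsto_of_tendsto_of_tendsto_of_le_of_le' tendsto_const_nhds hid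
      (hev.mono fun x hx => (hp x hx.1 hx.2).2.1.1.le)
      (hev.mono fun x hx => (hp x hx.1 hx.2).2.1.2.le)
  have l1 : Tendsto (fun x => α * c * ((a' + b' * x + c' * (p x).2) * (a' + c' * (p x).2)))
      (𝓝[>] 0) (𝓝 (α * c * ((a' + b' * 0 + c' * 0) * (a' + c' * 0)))) :=
    (((tendsto_const_nhds.add (hid.const_mul b')).add (t2.const_mul c')).mul
      (tendsto_const_nhds.add (t2.const_mul c'))).const_mul _
  have l2 : Tendsto (fun x => β * b' * ((a + b * (p x).1 + c * x) * (a + b * (p x).1)))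
      (𝓝[>] 0) (𝓝 (β * b' * ((a + b * 0 + c * 0) * (a + b * 0)))) :=
    (((tendsto_const_nhds.add (t1.const_mul b)).add (hid.const_mul c)).mul
      (tendsto_const_nhds.add (t1.const_mul b))).const_mul _
  have l3 := l2.congr' (hev.mono fun x hx => (hp x hx.1 hx.2).2.2.symm)
  have := tendsto_nhds_unique l1 l3
  linear_combination this

/-- Follows from `1 - 1/q ≤ log q ≤ q - 1` with `q = u' / u`. Here `u`, `h` stand for volume and gap
before, and `u'`, `h'` after, moving one facet by `δ`. -/
theorem log_bounds_of_sliver {u u' h h' α δ : ℝ} (hu : 0 < u) (hu' : 0 < u') (hh : 0 < h)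
    (hδ : 0 < δ) (hα : h' = h + (1 - α) * δ) (h1 : u * (h + δ) ≤ u' * h')
    (h2 : u' * (h' - δ) ≤ u * h) (h3 : 0 < h' - δ) :
    α * δ / (h + δ) ≤ Real.log u' - Real.log u ∧
      Real.log u' - Real.log u ≤ α * δ / (h' - δ) := by
  rw [← Real.log_div hu'.ne' hu.ne']
  have hq : 0 < u' / u := div_pos hu' hu
  constructor
  · refine le_trans ?_ (Real.one_sub_inv_le_log_of_pos hq)
    rw [inv_div]
    have : u / u' ≤ h' / (h + δ) := by
      rw [div_le_div_iff₀ hu' (by linarith)]; linarith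
    have e : α * δ / (h + δ) = 1 - h' / (h + δ) := by
      rw [eq_sub_iff_add_eq, ← add_div, hα, div_eq_one_iff_eq (by linarith)]; ring
    linarith
  · refine (Real.log_le_sub_one_of_pos hq).trans ?_
    have : u' / u ≤ h / (h' - δ) := by
      rw [div_le_div_iff₀ hu h3]; linarith
    have e : α * δ / (h' - δ) = h / (h' - δ) - 1 := by
      rw [eq_sub_iff_add_eq, div_add_one h3.ne', hα]; congr 1; ring
    linarith

end Analysis

/-! ### Volume and first moment of a sliver -/

section Volume

variable {V : Type*} [NormedAddCommGroup V] [NormedSpace ℝ V] [FiniteDimensional ℝ V]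
  [MeasurableSpace V] [BorelSpace V] (μ : Measure V) [μ.IsAddHaarMeasure]
  {ι : Type*} [Fintype ι] [DecidableEq ι] {η : ι → Module.Dual ℝ V} {κ : ι → ℝ}

theorem polytope_subset_add_single {i : ι} {δ : ℝ} (hδ : 0 ≤ δ) :
    polytope η κ ⊆ polytope η (κ + Pi.single i δ) := by
  intro x hx j
  have h0 : (0 : ι → ℝ) ≤ Pi.single i δ := Pi.single_nonneg.2 hδ
  exact (hx j).trans (le_add_of_nonneg_right (h0 j))

/-- The integral of the slack `κ i + δ - η i x` is volume times gap on the large polytope and `vol *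
(gap + δ)` on the small one. On the sliver between them this slack lies in `[0, δ]`. -/
theorem sliver_bounds {i : ι} {δ : ℝ} (hδ : 0 ≤ δ) (h : IsSimple η κ)
    (h' : IsSimple η (κ + Pi.single i δ)) :
    μ.real (polytope η κ) * (gap μ η κ i + δ) ≤
        μ.real (polytope η (κ + Pi.single i δ)) * gap μ η (κ + Pi.single i δ) i ∧
      μ.real (polytope η (κ + Pi.single i δ)) * (gap μ η (κ + Pi.single i δ) i - δ) ≤
        μ.real (polytope η κ) * gap μ η κ i := by
  set κ' := κ + Pi.single i δ with hκ'
  set P := polytope η κ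
  set P' := polytope η κ'
  have hsub : P ⊆ P' := polytope_subset_add_single hδ
  have hPm : MeasurableSet P := (isClosed_polytope η κ).measurableSet
  have hPm' : MeasurableSet P' := (isClosed_polytope η κ').measurableSet
  have hfin : μ (P' \ P) ≠ ⊤ := ((measure_mono Set.sdiff_subset).trans_lt (h'.measure_lt_top μ)).ne
  have hfin' : IsFiniteMeasure (μ.restrict (P' \ P)) :=
    ⟨by simpa only [Measure.restrict_apply_univ] using hfin.lt_top⟩
  have hvol : μ.real (P' \ P) = μ.real P' - μ.real P :=
    measureReal_sdiff hsub hPm (h'.measure_lt_top μ).ne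
  have hint : IntegrableOn (fun x => η i x) P' μ := h'.integrableOn μ (continuous_dual (η i))
  have hdiff : ∫ x in P' \ P, η i x ∂μ = μ.real P' * η i (centerOfMass μ η κ') -
      μ.real P * η i (centerOfMass μ η κ) := by
    rw [setIntegral_sdiff hPm hint hsub, h'.integral_apply μ, h.integral_apply μ]
  have hκi : κ' i = κ i + δ := by simp [hκ']
  have hbound : ∀ x ∈ P' \ P, κ i ≤ η i x ∧ η i x ≤ κ i + δ := by
    rintro x ⟨hx, hxP⟩
    refine ⟨?_, hκi ▸ hx i⟩
    by_contra hlt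
    refine hxP fun j => ?_
    by_cases hji : j = i
    · subst hji; exact (not_le.1 hlt).le
    · have := hx j
      simpa [hκ', hji] using this
  have hm : MeasurableSet (P' \ P) := hPm'.diff hPm
  have hint' := hint.mono_set (Set.sdiff_subset (t := P))
  have hlow : κ i * μ.real (P' \ P) ≤ ∫ x in P' \ P, η i x ∂μ := by
    have := setIntegral_mono_on (integrable_const (κ i)) hint' hm fun x hx => (hbound x hx).1
    simpa only [integral_const, measureReal_restrict_apply_univ, smul_eq_mul, mul_comm] using this
  have hupp : ∫ x in P' \ P, η i x ∂μ ≤ (κ i + δ) * μ.real (P' \ P) := by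
    have := setIntegral_mono_on hint' (integrable_const (κ i + δ)) hm fun x hx => (hbound x hx).2
    rw [integral_const, measureReal_restrict_apply_univ, smul_eq_mul] at this
    linarith
  rw [hdiff, hvol] at hlow hupp
  simp only [gap, hκi]
  constructor <;> linarith

theorem volume_lt_add_single {i : ι} {δ : ℝ} (hδ : 0 < δ) (h : IsSimple η κ)
    (h' : IsSimple η (κ + Pi.single i δ)) :
    μ.real (polytope η κ) < μ.real (polytope η (κ + Pi.single i δ)) := by
  set κ' := κ + Pi.single i δ with hκ'
  have hsub : polytope η κ ⊆ polytope η κ' := polytope_subset_add_single hδ.le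
  have hvol := measureReal_sdiff (μ := μ) hsub (isClosed_polytope η κ).measurableSet
    (h'.measure_lt_top μ).ne
  obtain ⟨p, hp, hpj⟩ := h.exists_relint i
  obtain ⟨w, hw⟩ := h.exists_apply_eq_one i
  have hfin : μ (polytope η κ' \ polytope η κ) ≠ ⊤ :=
    ((measure_mono Set.sdiff_subset).trans_lt (h'.measure_lt_top μ)).ne
  have hopen : IsOpen ({x | ∀ j, η j x < κ' j} ∩ {x | κ i < η i x}) :=
    (isOpen_interior_polytope η _).inter (isOpen_lt continuous_const (continuous_dual (η i)))
  have hne : ({x | ∀ j, η j x < κ' j} ∩ {x | κ i < η i x}).Nonempty := by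
    have hev := (eventually_lt_along η κ' p w).filter_mono
      (nhdsWithin_le_nhds (s := Set.Ioi 0))
    obtain ⟨t, ht, ht0⟩ := (hev.and self_mem_nhdsWithin).exists
    refine ⟨p + t • w, fun j => ht j ?_, ?_⟩
    · by_cases hji : j = i
      · subst hji; simp [hκ', hp, hδ]
      · simpa [hκ', hji] using hpj j hji
    · simpa [hp, hw] using ht0
  have hpos : 0 < μ.real (polytope η κ' \ polytope η κ) := by
    refine ENNReal.toReal_pos ?_ hfin
    refine ((hopen.measure_pos μ hne).trans_le (measure_mono ?_)).ne'
    exact fun x hx => ⟨fun j => (hx.1 j).le, fun hxP => (hx.2.out).not_ge (hxP i)⟩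
  linarith

end Volume

open Classical in
/-- After rescaling by the positive factors `c`, the conormals in each class of `S` have sum zero,
and these are the only linear relations between the rescaled conormals. -/
structure IsSimplexSplitting {V : Type*} [NormedAddCommGroup V] [NormedSpace ℝ V] {ι : Type*}
    [Fintype ι] (η : ι → Module.Dual ℝ V) (S : Setoid ι) (c : ι → ℝ) : Prop where
  pos : ∀ i, 0 < c i
  sum_eq_zero : ∀ i x, ∑ j with S i j, c j * η j x = 0
  exists_apply_eq : ∀ y : ι → ℝ, (∀ i, ∑ j with S i j, y j = 0) → ∃ x, ∀ i, c i * η i x = y i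

theorem continuous_single_real {ι : Type*} [DecidableEq ι] (i : ι) :
    Continuous fun s : ℝ => (Pi.single i s : ι → ℝ) :=
  continuous_single (A := fun _ : ι => ℝ) i

/-! ### From affine gaps to a splitting of the conormals -/

section GapMatrix

variable {V : Type*} [NormedAddCommGroup V] [NormedSpace ℝ V] [FiniteDimensional ℝ V]
  [MeasurableSpace V] [BorelSpace V] (μ : Measure V) [μ.IsAddHaarMeasure]
  {ι : Type*} [Fintype ι] [DecidableEq ι] {η : ι → Module.Dual ℝ V} {κ : ι → ℝ}

/-- On `U` all polytopes are simple and the gaps are affine functions of the support numbers, with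
linear part given by the matrix `a`. -/
structure IsGapMatrix (η : ι → Module.Dual ℝ V) (U : Set (ι → ℝ)) (a : ι → ι → ℝ) : Prop where
  isOpen : IsOpen U
  isSimple : ∀ κ ∈ U, IsSimple η κ
  gap_add : ∀ κ y, κ ∈ U → κ + y ∈ U → ∀ i, gap μ η (κ + y) i = gap μ η κ i + ∑ j, a i j * y j

variable {μ} {U : Set (ι → ℝ)} {a : ι → ι → ℝ}

theorem IsGapMatrix.gap_add_single (h : IsGapMatrix μ η U a) {i : ι} {t : ℝ} (hκ : κ ∈ U)
    (hκ' : κ + Pi.single i t ∈ U) (k : ι) :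
    gap μ η (κ + Pi.single i t) k = gap μ η κ k + a k i * t := by
  rw [h.gap_add κ _ hκ hκ' k]
  simp [Pi.single_apply]

theorem IsGapMatrix.exists_pos_mem (h : IsGapMatrix μ η U a) (hκ : κ ∈ U) (y : ι → ℝ) :
    ∃ t : ℝ, 0 < t ∧ κ + t • y ∈ U := by
  have hc : Continuous fun t : ℝ => κ + t • y := by fun_prop
  have h1 : ∀ᶠ t in 𝓝 (0 : ℝ), κ + t • y ∈ U :=
    hc.continuousAt.eventually_mem (h.isOpen.mem_nhds (by simpa using hκ))
  obtain ⟨t, h2, h3⟩ := ((h1.filter_mono (nhdsWithin_le_nhds (s := Set.Ioi 0))).and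
    self_mem_nhdsWithin).exists
  exact ⟨t, h3, h2⟩

theorem IsGapMatrix.log_bounds (h : IsGapMatrix μ η U a) {i : ι} {δ : ℝ} (hκ : κ ∈ U)
    (hκ' : κ + Pi.single i δ ∈ U) (hδ : 0 < δ) (hpos : 0 < gap μ η (κ + Pi.single i δ) i - δ) :
    (1 - a i i) * δ / (gap μ η κ i + δ) ≤
        Real.log (μ.real (polytope η (κ + Pi.single i δ))) - Real.log (μ.real (polytope η κ)) ∧
      Real.log (μ.real (polytope η (κ + Pi.single i δ))) - Real.log (μ.real (polytope η κ)) ≤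
        (1 - a i i) * δ / (gap μ η (κ + Pi.single i δ) i - δ) := by
  have hs := h.isSimple _ hκ
  have hs' := h.isSimple _ hκ'
  obtain ⟨h1, h2⟩ := sliver_bounds μ hδ.le hs hs'
  have e : gap μ η (κ + Pi.single i δ) i = gap μ η κ i + (1 - (1 - a i i)) * δ := by
    rw [h.gap_add_single hκ hκ']; ring
  exact log_bounds_of_sliver (hs.measureReal_pos μ) (hs'.measureReal_pos μ) (hs.gap_pos μ i) hδ e
    h1 h2 hpos

/-- Infinitesimally, `∂ᵢ(vol * gap i) = vol`, because the slack vanishes on the moving facet;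
dividing by the volume gives the formula. The sliver estimates make this rigorous. -/
theorem IsGapMatrix.hasDerivAt_log_volume (h : IsGapMatrix μ η U a) {i : ι} {t : ℝ}
    (ht : κ + Pi.single i t ∈ U) :
    HasDerivAt (fun s => Real.log (μ.real (polytope η (κ + Pi.single i s))))
      ((1 - a i i) / gap μ η (κ + Pi.single i t) i) t := by
  have hadd : ∀ s s' : ℝ, κ + Pi.single i s' = κ + Pi.single i s + Pi.single i (s' - s) := by
    intro s s'
    rw [add_assoc, ← Pi.single_add, add_sub_cancel]
  have hc : Continuous fun s : ℝ => κ + Pi.single i s :=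
    continuous_const.add (continuous_single_real i)
  have hU : ∀ᶠ s in 𝓝 t, κ + Pi.single i s ∈ U :=
    hc.continuousAt.eventually_mem (h.isOpen.mem_nhds ht)
  have hgap : ContinuousAt (fun s => gap μ η (κ + Pi.single i s) i) t := by
    have h1 : ContinuousAt (fun s => gap μ η (κ + Pi.single i t) i + a i i * (s - t)) t := by
      fun_prop
    refine h1.congr (hU.mono fun s hs => ?_)
    change _ = gap μ η (κ + Pi.single i s) i
    rw [hadd t s] at hs ⊢
    rw [h.gap_add_single ht hs]
  have hpos := (h.isSimple _ ht).gap_pos μ i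
  have hr : ∀ᶠ s in 𝓝 t, 0 < gap μ η (κ + Pi.single i s) i - (s - t) := by
    have h1 : ContinuousAt (fun s => gap μ η (κ + Pi.single i s) i - (s - t)) t :=
      hgap.sub (by fun_prop)
    exact continuousAt_const.eventually_lt h1 (by simpa using hpos)
  have hl : ∀ᶠ s in 𝓝 t, 0 < gap μ η (κ + Pi.single i t) i - (t - s) := by
    have h1 : ContinuousAt (fun s => gap μ η (κ + Pi.single i t) i - (t - s)) t := by fun_prop
    exact continuousAt_const.eventually_lt h1 (by simpa using hpos)
  refine hasDerivAt_of_slope_bounds hgap hpos ?_ ?_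
  · filter_upwards [hU, hr] with s hs hs' hlt
    rw [hadd t s] at hs hs' ⊢
    exact h.log_bounds ht hs (sub_pos.2 hlt) hs'
  · filter_upwards [hU, hl] with s hs hs' hlt
    rw [hadd s t] at ht hs' ⊢
    exact h.log_bounds hs ht (sub_pos.2 hlt) hs'

/-- Equality of the mixed partials of log volume, with denominators cleared. -/
theorem IsGapMatrix.symmetric (h : IsGapMatrix μ η U a) (hκ : κ ∈ U) (i j : ι) :
    (1 - a i i) * a i j * gap μ η κ j ^ 2 = (1 - a j j) * a j i * gap μ η κ i ^ 2 := by
  by_cases hij : i = j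
  · subst hij; rfl
  have hc : Continuous fun p : ℝ × ℝ => κ + Pi.single j p.2 + Pi.single i p.1 :=
    (continuous_const.add ((continuous_single j).comp continuous_snd)).add
      ((continuous_single_real i).comp continuous_fst)
  have hev : ∀ᶠ p in 𝓝 ((0 : ℝ), (0 : ℝ)), κ + Pi.single j p.2 + Pi.single i p.1 ∈ U :=
    hc.continuousAt.eventually_mem (h.isOpen.mem_nhds (by simpa using hκ))
  obtain ⟨ε, hε, hball⟩ := Metric.eventually_nhds_iff_ball.1 hev
  have hU : ∀ s t : ℝ, |s| < ε → |t| < ε → κ + Pi.single j t + Pi.single i s ∈ U := by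
    intro s t hs ht
    refine hball (s, t) ?_
    rw [mem_ball_iff_norm, Prod.norm_def]
    simpa using ⟨hs, ht⟩
  have h0 : |(0 : ℝ)| < ε := by simpa using hε
  have hgap : ∀ s t : ℝ, |s| < ε → |t| < ε → ∀ k,
      gap μ η (κ + Pi.single j t + Pi.single i s) k = gap μ η κ k + a k i * s + a k j * t := by
    intro s t hs ht k
    have hm : κ + Pi.single j t ∈ U := by simpa using hU 0 t h0 ht
    rw [h.gap_add_single hm (hU s t hs ht), h.gap_add_single hκ hm]
    ring
  refine mixed_deriv_eq (F := fun s t =>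
    Real.log (μ.real (polytope η (κ + Pi.single j t + Pi.single i s)))) hε ?_ ?_ ?_
    (b := a i i) (c' := a j j)
  · intro s t hs ht
    rw [← hgap s t hs ht, ← hgap s t hs ht]
    exact ⟨(h.isSimple _ (hU s t hs ht)).gap_pos μ i, (h.isSimple _ (hU s t hs ht)).gap_pos μ j⟩
  · intro s t hs ht
    rw [← hgap s t hs ht]
    exact h.hasDerivAt_log_volume (hU s t hs ht)
  · intro s t hs ht
    have hm := hU s t hs ht
    rw [← hgap s t hs ht]
    simp_rw [add_right_comm κ _ (Pi.single i s)] at hm ⊢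
    exact h.hasDerivAt_log_volume hm

/-- Pushing a facet outwards strictly increases the volume, so the upper bound for the increment of
its logarithm is positive. -/
theorem IsGapMatrix.diag_lt_one (h : IsGapMatrix μ η U a) (hκ : κ ∈ U) (i : ι) :
    0 < 1 - a i i := by
  have hs := h.isSimple κ hκ
  have hc : Continuous fun t : ℝ => κ + Pi.single i t :=
    continuous_const.add (continuous_single_real i)
  have h1 : ∀ᶠ t in 𝓝 (0 : ℝ), κ + Pi.single i t ∈ U :=
    hc.continuousAt.eventually_mem (h.isOpen.mem_nhds (by simpa using hκ))
  have h2 : ∀ᶠ t in 𝓝 (0 : ℝ), 0 < gap μ η κ i + a i i * t - t := by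
    have : ContinuousAt (fun t : ℝ => gap μ η κ i + a i i * t - t) 0 := by fun_prop
    exact continuousAt_const.eventually_lt this (by simpa using hs.gap_pos μ i)
  obtain ⟨t, ⟨h3, h4⟩, ht⟩ := (((h1.and h2).filter_mono
    (nhdsWithin_le_nhds (s := Set.Ioi 0))).and self_mem_nhdsWithin).exists
  rw [← h.gap_add_single hκ h3] at h4
  have hb := (h.log_bounds hκ h3 ht h4).2
  have hlt := Real.log_lt_log (hs.measureReal_pos μ)
    (volume_lt_add_single μ ht hs (h.isSimple _ h3))
  have hpos := (sub_pos.2 hlt).trans_le hb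
  have ht' : (0 : ℝ) < t := ht
  exact pos_of_mul_pos_left ((div_pos_iff_of_pos_right h4).1 hpos) ht'.le

/-- The symmetry relation at two points of `U` has the same coefficients, so the squared ratio of
gaps `i` and `j` is the same at both. Comparing `κ` with a shift in coordinate `k` gives the claim
for column `k`. -/
theorem IsGapMatrix.row_proportional (h : IsGapMatrix μ η U a) (hκ : κ ∈ U) {i j : ι}
    (hij : a i j ≠ 0) (k : ι) : a i k * gap μ η κ j = a j k * gap μ η κ i := by
  obtain ⟨t, ht, hm⟩ := h.exists_pos_mem hκ (Pi.single k 1)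
  have hsingle : t • (Pi.single k 1 : ι → ℝ) = Pi.single k t := by
    rw [← Pi.single_smul]; simp
  rw [hsingle] at hm
  have hE : (1 - a i i) * a i j ≠ 0 := mul_ne_zero (h.diag_lt_one hκ i).ne' hij
  have e1 := h.symmetric hκ i j
  have e2 := h.symmetric hm i j
  have p1 := (h.isSimple _ hκ).gap_pos μ
  have p2 := (h.isSimple _ hm).gap_pos μ
  have e3 : (gap μ η κ j * gap μ η (κ + Pi.single k t) i) ^ 2 =
      (gap μ η (κ + Pi.single k t) j * gap μ η κ i) ^ 2 := by
    apply mul_left_cancel₀ hE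
    linear_combination gap μ η (κ + Pi.single k t) i ^ 2 * e1 - gap μ η κ i ^ 2 * e2
  have e4 := (pow_left_inj₀ (mul_pos (p1 j) (p2 i)).le (mul_pos (p2 j) (p1 i)).le
    two_ne_zero).1 e3
  rw [h.gap_add_single hκ hm, h.gap_add_single hκ hm] at e4
  apply mul_left_cancel₀ ht.ne'
  linear_combination e4

/-- Translating the polytope by `x` changes `κ` by the values `η j x` and leaves every gap fixed. -/
theorem IsGapMatrix.sum_mul_apply (h : IsGapMatrix μ η U a) (hκ : κ ∈ U) (i : ι) (x : V) :
    ∑ j, a i j * η j x = 0 := by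
  obtain ⟨t, ht, hm⟩ := h.exists_pos_mem hκ fun j => η j x
  have e1 := h.gap_add _ _ hκ hm i
  have e2 : κ + t • (fun j => η j x) = fun j => κ j + η j (t • x) := by
    ext j; simp
  have e3 : gap μ η (κ + t • fun j => η j x) i = gap μ η κ i := by
    rw [e2, gap, gap, (h.isSimple κ hκ).centerOfMass_translate μ]
    simp
  rw [e3] at e1
  have e4 : ∑ j, a i j * (t • fun j => η j x) j = t * ∑ j, a i j * η j x := by
    rw [Finset.mul_sum]
    exact Finset.sum_congr rfl fun j _ => by simp; ring
  rw [e4] at e1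
  exact (mul_eq_zero.1 (by linarith : t * ∑ j, a i j * η j x = 0)).resolve_left ht.ne'

/-- Scaling `κ` scales the positive gaps, so no row can vanish. -/
theorem IsGapMatrix.exists_ne_zero (h : IsGapMatrix μ η U a) (hκ : κ ∈ U) (i : ι) :
    ∃ j, a i j ≠ 0 := by
  by_contra! hrow
  obtain ⟨t, ht, hm⟩ := h.exists_pos_mem hκ κ
  have e1 := h.gap_add _ _ hκ hm i
  have e2 : κ + t • κ = (1 + t) • κ := by module
  have e3 : gap μ η (κ + t • κ) i = (1 + t) * gap μ η κ i := by
    rw [e2, gap, gap, (h.isSimple κ hκ).centerOfMass_smul μ (by linarith)]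
    simp only [Pi.smul_apply, map_smul, smul_eq_mul]
    ring
  have hpos := mul_pos ht ((h.isSimple κ hκ).gap_pos μ i)
  simp only [e3, hrow, zero_mul, Finset.sum_const_zero] at e1
  linarith

/-- If the gaps do not change along `y`, then `y i` is the change of `η i` at the center of mass, so
the displacement of the center is the required vector. -/
theorem IsGapMatrix.exists_apply_eq (h : IsGapMatrix μ η U a) (hκ : κ ∈ U) {y : ι → ℝ}
    (hy : ∀ i, ∑ j, a i j * y j = 0) : ∃ x, ∀ i, η i x = y i := by
  obtain ⟨t, ht, hm⟩ := h.exists_pos_mem hκ y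
  refine ⟨t⁻¹ • (centerOfMass μ η (κ + t • y) - centerOfMass μ η κ), fun i => ?_⟩
  have e1 := h.gap_add _ _ hκ hm i
  have e2 : ∑ j, a i j * (t • y) j = 0 := by
    have : ∑ j, a i j * (t • y) j = t * ∑ j, a i j * y j := by
      rw [Finset.mul_sum]
      exact Finset.sum_congr rfl fun j _ => by simp; ring
    rw [this, hy, mul_zero]
  rw [e2, gap, gap] at e1
  simp only [Pi.add_apply, Pi.smul_apply, smul_eq_mul] at e1
  rw [map_smul, map_sub, smul_eq_mul, inv_mul_eq_iff_eq_mul₀ ht.ne']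
  linarith

/-- The classes are those of the relation `a i j ≠ 0`, and the scaling factors are the inverse gaps
at `κ`. Within a class the diagonal of `a` is constant, so row `i` is a nonzero multiple of the
inverse gaps there and zero elsewhere. -/
theorem IsGapMatrix.exists_isSimplexSplitting (h : IsGapMatrix μ η U a) (hκ : κ ∈ U) :
    ∃ S c, IsSimplexSplitting η S c := by
  classical
  set d := gap μ η κ with hd
  have hd0 : ∀ i, 0 < d i := (h.isSimple κ hκ).gap_pos μ
  have hsym : ∀ i j, (1 - a i i) * a i j * d j ^ 2 = (1 - a j j) * a j i * d i ^ 2 :=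
    fun i j => h.symmetric hκ i j
  have hrow : ∀ i j, a i j ≠ 0 → ∀ k, a i k * d j = a j k * d i :=
    fun i j hij k => h.row_proportional hκ hij k
  have hlt : ∀ i, 0 < 1 - a i i := h.diag_lt_one hκ
  have symm : ∀ i j, a i j ≠ 0 → a j i ≠ 0 := by
    intro i j hij h0
    have := hsym i j
    rw [h0, mul_zero, zero_mul] at this
    exact mul_ne_zero (mul_ne_zero (hlt i).ne' hij) (pow_ne_zero 2 (hd0 j).ne') this
  have hrefl : ∀ i, a i i ≠ 0 := by
    intro i h0
    obtain ⟨j, hj⟩ := h.exists_ne_zero hκ i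
    have := hrow i j hj i
    rw [h0, zero_mul] at this
    exact mul_ne_zero (symm i j hj) (hd0 i).ne' this.symm
  let S : Setoid ι :=
    { r := fun i j => a i j ≠ 0
      iseqv :=
        { refl := hrefl
          symm := fun {i j} => symm i j
          trans := fun {i j k} hij hjk h0 => by
            have := hrow i j hij k
            rw [h0, zero_mul] at this
            exact mul_ne_zero hjk (hd0 i).ne' this.symm } }
  have hS : ∀ i j, S i j ↔ a i j ≠ 0 := fun i j => Iff.rfl
  have hdiag : ∀ i j, a i j ≠ 0 → a j j = a i i := by
    intro i j hij
    have e1 : a i j * d j = a j j * d i := hrow i j hij j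
    have e2 : a j i * d i = a i i * d j := hrow j i (symm i j hij) i
    have e3 := hsym i j
    have e4 : (1 - a i i) * a j j * (d i * d j) = (1 - a j j) * a i i * (d i * d j) := by
      linear_combination e3 - (1 - a i i) * d j * e1 + (1 - a j j) * d i * e2
    have e5 := mul_right_cancel₀ (mul_pos (hd0 i) (hd0 j)).ne' e4
    linarith
  have hentry : ∀ i j, a i j ≠ 0 → a i j = a i i * d i * (d j)⁻¹ := by
    intro i j hij
    rw [eq_mul_inv_iff_mul_eq₀ (hd0 j).ne', hrow i j hij j, hdiag i j hij]
  have hsum : ∀ i (y : ι → ℝ), ∑ j, a i j * y j =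
      a i i * d i * ∑ j with S i j, (d j)⁻¹ * y j := by
    intro i y
    rw [Finset.mul_sum, Finset.sum_filter]
    refine Finset.sum_congr rfl fun j _ => ?_
    split_ifs with hij
    · rw [hentry i j hij, mul_assoc]
    · rw [not_not.1 ((hS i j).not.1 hij), zero_mul]
  refine ⟨S, fun i => (d i)⁻¹, fun i => inv_pos.2 (hd0 i), fun i x => ?_, fun y hy => ?_⟩
  · have e := h.sum_mul_apply hκ i x
    rw [hsum i fun j => η j x] at e
    exact (mul_eq_zero.1 e).resolve_left (mul_ne_zero (hrefl i) (hd0 i).ne')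
  · obtain ⟨x, hx⟩ := h.exists_apply_eq hκ (y := fun j => d j * y j) fun i => by
      rw [hsum i fun j => d j * y j]
      have : ∀ j, (d j)⁻¹ * (d j * y j) = y j := fun j => inv_mul_cancel_left₀ (hd0 j).ne' _
      simp_rw [this, hy, mul_zero]
    exact ⟨x, fun i => by rw [hx, inv_mul_cancel_left₀ (hd0 i).ne']⟩

end GapMatrix

theorem IsSimple.exists_isSimplexSplitting_of_isMassLinear
    {V : Type*} [NormedAddCommGroup V] [NormedSpace ℝ V] [FiniteDimensional ℝ V]
    [MeasurableSpace V] [BorelSpace V] (μ : Measure V) [μ.IsAddHaarMeasure]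
    {ι : Type*} [Fintype ι] {η : ι → Module.Dual ℝ V} {κ : ι → ℝ} (h : IsSimple η κ)
    (hml : ∀ H : Module.Dual ℝ V, IsMassLinear μ η κ H) :
    ∃ S c, IsSimplexSplitting η S c := by
  classical
  obtain ⟨ε, hε, hball⟩ := h.exists_ball_subset_chamber
  choose γ C hγ using hml
  have hg : IsGapMatrix μ η (Metric.ball κ ε) fun i j => (Pi.single i 1 : ι → ℝ) j - γ (η i) j := by
    refine ⟨Metric.isOpen_ball, fun κ' hκ' => isSimple_of_mem_chamber (hball hκ'), ?_⟩
    intro κ' y h1 h2 i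
    rw [gap, gap, hγ (η i) _ (hball h1), hγ (η i) _ (hball h2)]
    simp only [Pi.add_apply, mul_add, sub_mul, Finset.sum_add_distrib, Finset.sum_sub_distrib,
      Pi.single_apply, ite_mul, one_mul, zero_mul, Finset.sum_ite_eq', Finset.mem_univ, if_true]
    ring
  exact hg.exists_isSimplexSplitting (Metric.mem_ball_self hε)

/-- The closure properties of the sets of admissible linear parts of symmetries. -/
structure IsLinearGroup {V : Type*} [NormedAddCommGroup V] [NormedSpace ℝ V]
    (G : Set (V →ₗ[ℝ] V)) : Prop where
  id_mem : LinearMap.id ∈ G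
  comp_mem : ∀ f ∈ G, ∀ g ∈ G, f ∘ₗ g ∈ G
  inv_mem : ∀ f ∈ G, ∀ g : V →ₗ[ℝ] V, g ∘ₗ f = LinearMap.id → g ∈ G

/-! ### Uniqueness of facet inequalities -/

section Uniqueness

variable {V : Type*} [NormedAddCommGroup V] [NormedSpace ℝ V] [FiniteDimensional ℝ V]
  {ι : Type*} [Finite ι] {η : ι → Module.Dual ℝ V} {κ : ι → ℝ}

/-- Uniqueness of facet inequalities: a facet inequality occurs, up to a positive factor, in every
system of inequalities for the polytope. -/
theorem exists_pos_smul_of_polytope_eq {K : Type*} [Finite K] {θ : K → Module.Dual ℝ V} {τ : K → ℝ}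
    (hP : polytope η κ = polytope θ τ) {q : V} (hq : ∀ i, η i q < κ i) (hq' : ∀ k, θ k q < τ k)
    {i : ι} {p : V} (hp : η i p = κ i) (hpj : ∀ j, j ≠ i → η j p < κ j) :
    ∃ k, ∃ c : ℝ, 0 < c ∧ (∀ x, θ k x = c * η i x) ∧ τ k = c * κ i := by
  have hpP : p ∈ polytope η κ := fun j => by
    by_cases hj : j = i
    · subst hj; exact hp.le
    · exact (hpj j hj).le
  have hpP' := hpP
  rw [hP] at hpP'
  have hs : 0 < η i (p - q) := by rw [map_sub, hp]; exact sub_pos.2 (hq i)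
  -- If no inequality of the second system were tight at `p`, one could move past facet `i` inside
  -- the polytope.
  obtain ⟨k, hk⟩ : ∃ k, θ k p = τ k := by
    by_contra! hne
    obtain ⟨t, ht, h1, -⟩ := exists_pos_lt_along θ τ p (p - q)
    have hm : p + t • (p - q) ∈ polytope θ τ :=
      fun k => (h1 k (lt_of_le_of_ne (hpP' k) (hne k))).le
    rw [← hP] at hm
    have := hm i
    rw [map_add, map_smul, hp, smul_eq_mul] at this
    linarith [mul_pos ht hs]
  have hs' : 0 < θ k (p - q) := by rw [map_sub, hk]; exact sub_pos.2 (hq' k)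
  -- Directions tangent to facet `i` can be followed both ways from `p`, so `θ k`, which is maximal
  -- at `p`, is constant along them.
  have hker : ∀ w, η i w = 0 → θ k w = 0 := by
    intro w hw
    obtain ⟨t, ht, h1, h2⟩ := exists_pos_lt_along η κ p w
    have key : ∀ s : ℝ, (∀ j, η j p < κ j → η j (p + s • w) < κ j) → s * θ k w ≤ 0 := by
      intro s hs
      have hm : p + s • w ∈ polytope η κ := fun j => by
        by_cases hj : j = i
        · subst hj; simp [hp, hw]
        · exact (hs j (hpj j hj)).le
      rw [hP] at hm
      have := hm k
      rw [map_add, map_smul, hk, smul_eq_mul] at this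
      linarith
    have k1 := key t h1
    have k2 := key (-t) h2
    exact (mul_eq_zero.1 (by linarith : t * θ k w = 0)).resolve_left ht.ne'
  have hθ : ∀ x, θ k x = θ k (p - q) / η i (p - q) * η i x := by
    intro x
    have h0 : η i (x - (η i x / η i (p - q)) • (p - q)) = 0 := by
      rw [map_sub, map_smul, smul_eq_mul, div_mul_cancel₀ _ hs.ne', sub_self]
    have h1 := hker _ h0
    rw [map_sub, map_smul, smul_eq_mul] at h1
    rw [sub_eq_zero.1 h1]
    ring
  exact ⟨k, _, div_pos hs' hs, hθ, by rw [← hk, ← hp, hθ p]⟩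

theorem eq_of_pos_smul (hrel : ∀ i, ∃ p, η i p = κ i ∧ ∀ j, j ≠ i → η j p < κ j) {i k : ι} {c : ℝ}
    (hc : 0 < c) (hik : ∀ x, η i x = c * η k x) : i = k := by
  by_contra hne
  obtain ⟨p, hp, hpj⟩ := hrel i
  obtain ⟨r, hr, hrj⟩ := hrel k
  have h1 := mul_lt_mul_of_pos_left (hpj k (Ne.symm hne)) hc
  have h2 := hrj i hne
  rw [← hik, hp] at h1
  rw [hik, hr] at h2
  exact lt_asymm h1 h2

/-- Such an `x` would be a recession direction of a bounded set. -/
theorem IsSimple.eq_zero_of_forall_apply_nonpos (h : IsSimple η κ) {x : V}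
    (hx : ∀ i, η i x ≤ 0) : x = 0 := by
  by_contra hne
  obtain ⟨q, hq⟩ := h.nonempty
  obtain ⟨R, hR⟩ := h.bounded.exists_norm_le
  have hxn : 0 < ‖x‖ := norm_pos_iff.2 hne
  obtain ⟨t, ht⟩ := exists_gt ((R + ‖q‖) / ‖x‖)
  have hR0 : 0 ≤ R := (norm_nonneg q).trans (hR q hq)
  have ht0 : 0 < t := lt_of_le_of_lt (by positivity) ht
  have hm : q + t • x ∈ polytope η κ := fun i => by
    rw [map_add, map_smul, smul_eq_mul]
    have := mul_nonpos_of_nonneg_of_nonpos ht0.le (hx i)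
    linarith [hq i]
  have h1 := hR _ hm
  have h2 : ‖t • x‖ ≤ ‖q + t • x‖ + ‖q‖ := by
    have := norm_sub_le (q + t • x) q
    rwa [add_sub_cancel_left] at this
  rw [norm_smul, Real.norm_of_nonneg ht0.le] at h2
  rw [div_lt_iff₀ hxn] at ht
  linarith

end Uniqueness

/-! ### Symmetries, facet classes and inessential functionals -/

section Symmetry

variable {V : Type*} [NormedAddCommGroup V] [NormedSpace ℝ V] [FiniteDimensional ℝ V]
  {ι : Type*} [Fintype ι] {η : ι → Module.Dual ℝ V} {κ : ι → ℝ} {G : Set (V →ₗ[ℝ] V)}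

theorem IsSimple.bijective_of_image_eq (h : IsSimple η κ) {a : V →ᵃ[ℝ] V}
    (ha : a '' polytope η κ = polytope η κ) : Function.Bijective a := by
  have hsurj : Function.Surjective a := by
    have h1 := AffineSubspace.map_span (k := ℝ) a (polytope η κ)
    rw [ha, h.affineSpan_eq_top] at h1
    intro y
    have hy : y ∈ (⊤ : AffineSubspace ℝ V).map a := by
      rw [h1]; exact AffineSubspace.mem_top ℝ V y
    obtain ⟨x, -, hx⟩ := (AffineSubspace.mem_map).1 hy
    exact ⟨x, hx⟩
  refine ⟨?_, hsurj⟩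
  rw [← AffineMap.linear_injective_iff]
  exact LinearMap.injective_iff_surjective.2 ((AffineMap.linear_surjective_iff a).2 hsurj)

/-- A symmetry of a simple polytope permutes the facet inequalities up to positive factors. -/
theorem IsSimple.exists_slack_eq (h : IsSimple η κ) {a : V →ᵃ[ℝ] V}
    (ha : a '' polytope η κ = polytope η κ) (k : ι) :
    ∃ i, ∃ c : ℝ, 0 < c ∧ (∀ x, η i x = c * η k (a.linear x)) ∧
      ∀ x, κ i - η i x = c * (κ k - η k (a x)) := by
  obtain ⟨hinj, hsurj⟩ := h.bijective_of_image_eq ha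
  have hdec : ∀ x, a x = a.linear x + a 0 := fun x => congrFun (AffineMap.decomp a) x
  have hiff : ∀ x j, (η j ∘ₗ a.linear) x - (κ j - η j (a 0)) = η j (a x) - κ j := by
    intro x j
    rw [hdec x, map_add, LinearMap.comp_apply]
    ring
  -- Pulling the inequalities back along `a` gives a second system for the same polytope, so
  -- uniqueness of facet inequalities applies.
  have hP : polytope (fun j => η j ∘ₗ a.linear) (fun j => κ j - η j (a 0)) = polytope η κ := by
    ext x
    have h1 : x ∈ polytope (fun j => η j ∘ₗ a.linear) (fun j => κ j - η j (a 0)) ↔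
        a x ∈ polytope η κ := by
      refine forall_congr' fun j => ?_
      rw [← sub_nonpos, hiff, sub_nonpos]
    rw [h1]
    conv_lhs => rw [← ha]
    exact hinj.mem_set_image
  obtain ⟨q, hq⟩ := h.exists_interior
  obtain ⟨p, hp, hpj⟩ := h.exists_relint k
  obtain ⟨p', rfl⟩ := hsurj p
  have hint : ∃ r, (∀ j, (η j ∘ₗ a.linear) r < κ j - η j (a 0)) ∧ ∀ j, η j r < κ j := by
    have hopen : IsOpen {x | ∀ j, (η j ∘ₗ a.linear) x < κ j - η j (a 0)} :=
      isOpen_interior_polytope _ _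
    obtain ⟨r, rfl⟩ := hsurj q
    have hr : ∀ j, (η j ∘ₗ a.linear) r < κ j - η j (a 0) := fun j => by
      rw [← sub_neg, hiff, sub_neg]; exact hq j
    refine ⟨r, hr, fun j => ?_⟩
    have hrP : r ∈ interior (polytope η κ) := by
      rw [← hP]
      exact interior_maximal (fun x hx j => (hx j).le) hopen hr
    obtain ⟨w, hw⟩ := h.exists_apply_eq_one j
    have hc : Continuous fun t : ℝ => r + t • w := by fun_prop
    have hev : ∀ᶠ t in 𝓝 (0 : ℝ), r + t • w ∈ interior (polytope η κ) :=
      hc.continuousAt.eventually_mem (isOpen_interior.mem_nhds (by simpa using hrP))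
    obtain ⟨t, ht, ht0⟩ := ((hev.filter_mono (nhdsWithin_le_nhds (s := Set.Ioi 0))).and
      self_mem_nhdsWithin).exists
    have := interior_subset ht j
    rw [map_add, map_smul, hw, smul_eq_mul, mul_one] at this
    have ht0' : 0 < t := ht0
    linarith
  obtain ⟨r, hr, hr'⟩ := hint
  obtain ⟨i, c, hc, h1, h2⟩ := exists_pos_smul_of_polytope_eq hP hr hr' (i := k) (p := p')
    (by rw [← sub_eq_zero, hiff, hp, sub_self])
    (fun j hj => by rw [← sub_neg, hiff, sub_neg]; exact hpj j hj)
  refine ⟨i, c, hc, h1, fun x => ?_⟩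
  rw [h1, h2]
  linear_combination -c * hiff x k

theorem IsSimple.slack_eq_of_facet (h : IsSimple η κ) {a : V →ᵃ[ℝ] V}
    (ha : a '' polytope η κ = polytope η κ) {i j : ι} (hij : a '' facet η κ i = facet η κ j) :
    ∃ c : ℝ, 0 < c ∧ (∀ x, η i x = c * η j (a.linear x)) ∧
      ∀ x, κ i - η i x = c * (κ j - η j (a x)) := by
  obtain ⟨k, c, hc, h1, h2⟩ := h.exists_slack_eq ha j
  obtain ⟨p, hp, hpj⟩ := h.exists_relint i
  have hpF : p ∈ facet η κ i := by
    refine ⟨fun l => ?_, hp⟩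
    by_cases hl : l = i
    · subst hl; exact hp.le
    · exact (hpj l hl).le
  have hap : a p ∈ facet η κ j := hij ▸ Set.mem_image_of_mem a hpF
  have h3 := h2 p
  rw [hap.2.out, sub_self, mul_zero, sub_eq_zero] at h3
  have hki : k = i := by
    by_contra hne
    exact (hpj k hne).ne h3.symm
  subst hki
  exact ⟨c, hc, h1, h2⟩

theorem facetEquiv_refl (hG : IsLinearGroup G) (i : ι) : FacetEquiv G η κ i i :=
  ⟨LinearMap.id, fun κ' _ => ⟨AffineMap.id ℝ V, ⟨hG.id_mem, by simp⟩, rfl, by simp⟩⟩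

theorem facetEquiv_trans (hG : IsLinearGroup G) {i j k : ι} (h1 : FacetEquiv G η κ i j)
    (h2 : FacetEquiv G η κ j k) : FacetEquiv G η κ i k := by
  obtain ⟨f, hf⟩ := h1
  obtain ⟨g, hg⟩ := h2
  refine ⟨g ∘ₗ f, fun κ' hκ' => ?_⟩
  obtain ⟨a, ⟨ha1, ha2⟩, ha3, ha4⟩ := hf κ' hκ'
  obtain ⟨b, ⟨hb1, hb2⟩, hb3, hb4⟩ := hg κ' hκ'
  refine ⟨b.comp a, ⟨?_, ?_⟩, ?_, ?_⟩
  · exact hG.comp_mem _ hb1 _ ha1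
  · rw [AffineMap.coe_comp, Set.image_comp, ha2, hb2]
  · rw [AffineMap.comp_linear, ha3, hb3]
  · rw [AffineMap.coe_comp, Set.image_comp, ha4, hb4]

theorem facetEquiv_symm (hG : IsLinearGroup G) (h : IsSimple η κ) {i j : ι}
    (h1 : FacetEquiv G η κ i j) : FacetEquiv G η κ j i := by
  obtain ⟨f, hf⟩ := h1
  have hbij : Function.Bijective f := by
    obtain ⟨a, ⟨-, ha⟩, rfl, -⟩ := hf κ h.mem_chamber
    exact ⟨(AffineMap.linear_injective_iff a).2 (h.bijective_of_image_eq ha).1,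
      (AffineMap.linear_surjective_iff a).2 (h.bijective_of_image_eq ha).2⟩
  let e := LinearEquiv.ofBijective f hbij
  refine ⟨e.symm, fun κ' hκ' => ?_⟩
  obtain ⟨a, ⟨ha1, ha2⟩, ha3, ha4⟩ := hf κ' hκ'
  have hes : ∀ x, e.symm (f x) = x := fun x => e.symm_apply_apply x
  let b : V →ᵃ[ℝ] V := (e.symm : V →ₗ[ℝ] V).toAffineMap + AffineMap.const ℝ V (-e.symm (a 0))
  have hba : ∀ x, b (a x) = x := by
    intro x
    have hdec : a x = f x + a 0 := by rw [← ha3]; exact congrFun (AffineMap.decomp a) x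
    simp [b, hdec, hes]
  have himg : ∀ s : Set V, b '' (a '' s) = s := by
    intro s
    rw [Set.image_image]
    simp only [hba, Set.image_id']
  have hbl : b.linear = (e.symm : V →ₗ[ℝ] V) := by simp [b]
  refine ⟨b, ⟨?_, ?_⟩, hbl, ?_⟩
  · rw [hbl]
    refine hG.inv_mem a.linear ha1 _ ?_
    rw [ha3]
    exact LinearMap.ext hes
  · conv_lhs => rw [← ha2]
    exact himg _
  · rw [← ha4]
    exact himg _

theorem IsSimple.equivalence_facetEquiv (hG : IsLinearGroup G) (h : IsSimple η κ) :
    Equivalence (FacetEquiv G η κ) :=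
  ⟨facetEquiv_refl hG, facetEquiv_symm hG h, facetEquiv_trans hG⟩

/-- A symmetry matches slacks only up to a positive factor; normalization makes this factor one for
the rescaled conormals `c i • η i`. -/
theorem FacetEquiv.slack_eq {ζ : ι → Module.Dual ℝ V}
    (hζ : IsNormalizedConormals G η κ ζ) {c : ι → ℝ} (hc : ∀ i, 0 < c i)
    (hcζ : ∀ i, ζ i = c i • η i) {i j : ι} {f : V →ₗ[ℝ] V}
    (hf : ∀ κ' ∈ chamber η κ, ∃ a : V →ᵃ[ℝ] V,
      IsSymmetry G (polytope η κ') a ∧ a.linear = f ∧ a '' facet η κ' i = facet η κ' j)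
    {κ' : ι → ℝ} (hκ' : κ' ∈ chamber η κ) :
    ∃ a : V →ᵃ[ℝ] V, a '' polytope η κ' = polytope η κ' ∧
      ∀ x, c i * (κ' i - η i x) = c j * (κ' j - η j (a x)) := by
  have hrob : IsRobustSymmetry G η κ f := fun κ' hκ' => by
    obtain ⟨a, h1, h2, -⟩ := hf κ' hκ'
    exact ⟨a, h1, h2⟩
  obtain ⟨k, hk⟩ := hζ.2 f hrob j
  have hk' : ∀ x, c j * η j (f x) = c k * η k x := by
    intro x
    have := congrArg (fun g => g x) hk
    simpa [hcζ] using this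
  obtain ⟨a, ⟨-, ha⟩, hlin, hfac⟩ := hf κ' hκ'
  have hs := isSimple_of_mem_chamber hκ'
  obtain ⟨d, hd, h1, h2⟩ := hs.slack_eq_of_facet ha hfac
  rw [hlin] at h1
  have hik : i = k := by
    refine eq_of_pos_smul hs.exists_relint (c := d * (c k / c j))
      (mul_pos hd (div_pos (hc k) (hc j))) fun x => ?_
    rw [h1 x, mul_assoc, div_mul_eq_mul_div, ← hk' x, mul_div_cancel_left₀ _ (hc j).ne']
  subst hik
  obtain ⟨w, hw⟩ := hs.exists_apply_eq_one i
  have e1 := hk' w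
  have e2 := h1 w
  rw [hw] at e1 e2
  have e3 : c i * d = c j := by
    linear_combination -d * e1 - c j * e2
  refine ⟨a, ha, fun x => ?_⟩
  rw [h2 x, ← mul_assoc, e3]

theorem sum_mul_eq_zero_of_class_sums {ι : Type*} [Fintype ι] {r : ι → ι → Prop}
    [DecidableRel r] (hr : Equivalence r) {β g : ι → ℝ} (hβ : ∀ i, ∑ j with r i j, β j = 0)
    (hg : ∀ i j, r i j → g i = g j) : ∑ j, β j * g j = 0 := by
  classical
  let S : Setoid ι := ⟨r, hr⟩
  rw [Finset.sum_partition S]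
  refine Finset.sum_eq_zero fun q hq => ?_
  obtain ⟨i, -, rfl⟩ := Finset.mem_image.1 hq
  have h1 : ∀ j ∈ Finset.univ.filter (fun j => (⟦j⟧ : Quotient S) = ⟦i⟧),
      β j * g j = β j * g i := by
    intro j hj
    rw [hg i j (hr.symm (Quotient.exact (Finset.mem_filter.1 hj).2))]
  rw [Finset.sum_congr rfl h1, ← Finset.sum_mul]
  have h2 : Finset.univ.filter (fun j => (⟦j⟧ : Quotient S) = ⟦i⟧) =
      Finset.univ.filter (fun j => r i j) := by
    ext j
    simp only [Finset.mem_filter, Finset.mem_univ, true_and]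
    exact Quotient.eq.trans ⟨fun h => hr.symm h, fun h => hr.symm h⟩
  rw [h2, hβ, zero_mul]

/-- The symmetries of `Δ(κ')` fix its center of mass, so the normalized slacks there are constant on
classes and the combination with coefficients `β` vanishes. -/
theorem IsSimple.isMassLinear_of_isInessential [MeasurableSpace V] [BorelSpace V] (μ : Measure V)
    [μ.IsAddHaarMeasure] (hG : IsLinearGroup G) (h : IsSimple η κ) {H : Module.Dual ℝ V}
    (hH : IsInessential G η κ H) : IsMassLinear μ η κ H := by
  classical
  obtain ⟨ζ, hζ, β, rfl, hβ⟩ := hH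
  choose c hc hcζ using hζ.1
  refine ⟨fun i => β i * c i, 0, fun κ' hκ' => ?_⟩
  have hs := isSimple_of_mem_chamber hκ'
  have key : ∑ i, β i * (c i * (κ' i - η i (centerOfMass μ η κ'))) = 0 := by
    refine sum_mul_eq_zero_of_class_sums (h.equivalence_facetEquiv hG) (fun i => ?_) ?_
    · convert hβ i using 2
      ext j
      simp only [Finset.mem_filter, Finset.mem_univ, true_and]
      exact Iff.rfl
    · rintro i j ⟨f, hf⟩
      obtain ⟨a, ha, hax⟩ := FacetEquiv.slack_eq hζ hc hcζ hf hκ'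
      rw [hax, ← hs.centerOfMass_of_image μ a (hs.bijective_of_image_eq ha).1 ha]
  simp only [mul_sub, Finset.sum_sub_distrib] at key
  rw [sub_eq_zero] at key
  simp only [LinearMap.sum_apply, LinearMap.smul_apply, hcζ, smul_eq_mul, add_zero, mul_assoc]
  exact key.symm

/-- The conormals normalized by the distances from the center of mass. -/
theorem IsSimple.isNormalizedConormals_gap [MeasurableSpace V] [BorelSpace V] (μ : Measure V)
    [μ.IsAddHaarMeasure] (h : IsSimple η κ) :
    IsNormalizedConormals G η κ fun i => (gap μ η κ i)⁻¹ • η i := by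
  refine ⟨fun i => ⟨_, inv_pos.2 (h.gap_pos μ i), rfl⟩, fun f hf k => ?_⟩
  obtain ⟨a, ⟨-, ha⟩, rfl⟩ := hf κ h.mem_chamber
  obtain ⟨i, c, hc, h1, h2⟩ := h.exists_slack_eq ha k
  refine ⟨i, LinearMap.ext fun x => ?_⟩
  have h3 := h2 (centerOfMass μ η κ)
  rw [← h.centerOfMass_of_image μ a (h.bijective_of_image_eq ha).1 ha] at h3
  change gap μ η κ i = c * gap μ η κ k at h3
  have hk := (h.gap_pos μ k).ne'
  simp only [LinearMap.comp_apply, LinearMap.smul_apply, smul_eq_mul, h1, h3]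
  field_simp

/-- Duality: a vector annihilating the inessential functionals gives equal values to the normalized
conormals of a class, and the ray it spans from the center leaves the polytope through a common
point of a whole class. -/
theorem IsSimple.isInessential_of_iInter_facet [MeasurableSpace V] [BorelSpace V] (μ : Measure V)
    [μ.IsAddHaarMeasure] (hG : IsLinearGroup G) (h : IsSimple η κ)
    (h4 : ∀ i, ⋂ j ∈ facetClass G η κ i, facet η κ j = ∅) (H : Module.Dual ℝ V) :
    IsInessential G η κ H := by
  classical
  set ζ : ι → Module.Dual ℝ V := fun i => (gap μ η κ i)⁻¹ • η i with hζ
  have hE := h.equivalence_facetEquiv hG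
  have hnorm : IsNormalizedConormals G η κ ζ := h.isNormalizedConormals_gap μ
  let W : Submodule ℝ (Module.Dual ℝ V) :=
    { carrier := {H | ∃ β : ι → ℝ, H = ∑ i, β i • ζ i ∧
        ∀ i, ∑ j with j ∈ facetClass G η κ i, β j = 0}
      zero_mem' := ⟨0, by simp, by simp⟩
      add_mem' := by
        rintro _ _ ⟨β, rfl, hβ⟩ ⟨β', rfl, hβ'⟩
        refine ⟨β + β', by simp [add_smul, Finset.sum_add_distrib], fun i => ?_⟩
        simp only [Pi.add_apply, Finset.sum_add_distrib, hβ, hβ', add_zero]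
      smul_mem' := by
        rintro r _ ⟨β, rfl, hβ⟩
        refine ⟨r • β, by simp [mul_smul, Finset.smul_sum], fun i => ?_⟩
        simp only [Pi.smul_apply, ← Finset.smul_sum, hβ, smul_zero] }
  suffices hW : W = ⊤ by
    have hm : H ∈ W := hW ▸ Submodule.mem_top
    obtain ⟨β, h1, h2⟩ := hm
    exact ⟨ζ, hnorm, β, h1, fun i => by convert h2 i⟩
  by_contra hne
  obtain ⟨φ, hφ0, hφ⟩ := Submodule.exists_le_ker_of_lt_top W (lt_top_iff_ne_top.2 hne)
  obtain ⟨x, rfl⟩ := (Module.evalEquiv ℝ V).surjective φ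
  have hx0 : x ≠ 0 := by
    rintro rfl
    exact hφ0 (map_zero _)
  have hconst : ∀ i j, FacetEquiv G η κ i j → ζ j x = ζ i x := by
    intro i j hij
    have hm : ζ j - ζ i ∈ W := by
      refine ⟨fun l => (if l = j then (1 : ℝ) else 0) - if l = i then 1 else 0, ?_, fun k => ?_⟩
      · refine LinearMap.ext fun z => ?_
        simp only [LinearMap.sub_apply, LinearMap.sum_apply, LinearMap.smul_apply, smul_eq_mul,
          sub_mul, Finset.sum_sub_distrib, ite_mul, one_mul, zero_mul, Finset.sum_ite_eq',
          Finset.mem_univ, if_true]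
      · have hiff : FacetEquiv G η κ k j ↔ FacetEquiv G η κ k i :=
          ⟨fun hk => hE.trans hk (hE.symm hij), fun hk => hE.trans hk hij⟩
        have hiff' : j ∈ facetClass G η κ k ↔ i ∈ facetClass G η κ k := hiff
        simp only [Finset.sum_sub_distrib, Finset.sum_ite_eq',
          Finset.mem_filter, Finset.mem_univ, true_and, hiff', sub_self]
    have := hφ hm
    rw [LinearMap.mem_ker, Module.evalEquiv_apply, map_sub, sub_eq_zero] at this
    exact this
  obtain ⟨i₀, hi₀⟩ : ∃ i, 0 < η i x := by
    by_contra! hle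
    exact hx0 (h.eq_zero_of_forall_apply_nonpos hle)
  have : Nonempty ι := ⟨i₀⟩
  -- The ray first meets the facets with the largest `ζ k x`, at time `(ζ i x)⁻¹`, because all gaps
  -- have been normalized to one.
  obtain ⟨i, hi⟩ := Finite.exists_max fun k => ζ k x
  have hM : 0 < ζ i x :=
    lt_of_lt_of_le (mul_pos (inv_pos.2 (h.gap_pos μ i₀)) hi₀) (hi i₀)
  set y := centerOfMass μ η κ + (ζ i x)⁻¹ • x
  have hslack : ∀ k, κ k - η k y = gap μ η κ k * (1 - (ζ i x)⁻¹ * ζ k x) := by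
    intro k
    have e : gap μ η κ k * ζ k x = η k x :=
      mul_inv_cancel_left₀ (h.gap_pos μ k).ne' (η k x)
    simp only [y, map_add, map_smul, smul_eq_mul]
    rw [mul_sub, mul_left_comm, e, mul_one]
    simp only [gap]
    ring
  have hyP : y ∈ polytope η κ := by
    intro k
    rw [← sub_nonneg, hslack]
    refine mul_nonneg (h.gap_pos μ k).le (sub_nonneg.2 ?_)
    rw [inv_mul_le_iff₀ hM, mul_one]
    exact hi k
  have hmem : y ∈ ⋂ j ∈ facetClass G η κ i, facet η κ j := by
    simp only [Set.mem_iInter]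
    intro j hj
    refine ⟨hyP, ?_⟩
    have := hslack j
    rw [hconst i j hj, inv_mul_cancel₀ hM.ne', sub_self, mul_zero, sub_eq_zero] at this
    exact this.symm
  rw [h4 i] at hmem
  exact hmem

theorem IsSimple.one_lt_ncard_facetClass (hG : IsLinearGroup G) (h : IsSimple η κ)
    (h4 : ∀ i, ⋂ j ∈ facetClass G η κ i, facet η κ j = ∅) (i : ι) :
    1 < (facetClass G η κ i).ncard := by
  have hi : i ∈ facetClass G η κ i := facetEquiv_refl hG i
  by_contra hle
  have hsub := (Set.ncard_le_one (Set.toFinite _)).1 (not_lt.1 hle)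
  obtain ⟨x, hx⟩ := h.facet_nonempty i
  have hmem : x ∈ ⋂ j ∈ facetClass G η κ i, facet η κ j := by
    simp only [Set.mem_iInter]
    intro j hj
    rwa [hsub j hj i hi]
  rw [h4 i] at hmem
  exact hmem

end Symmetry

/-! ### Splittings give symmetries and product coordinates -/

section Splitting

variable {V : Type*} [NormedAddCommGroup V] [NormedSpace ℝ V] [FiniteDimensional ℝ V]
  {ι : Type*} [Fintype ι] {η : ι → Module.Dual ℝ V} {κ : ι → ℝ} {G : Set (V →ₗ[ℝ] V)}
  {S : Setoid ι} {c : ι → ℝ}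

theorem IsSimple.eq_of_forall_apply_eq (h : IsSimple η κ) {x y : V} (hxy : ∀ i, η i x = η i y) :
    x = y :=
  sub_eq_zero.1 (h.eq_zero_of_forall_apply_nonpos fun i => by rw [map_sub, hxy, sub_self])

open Classical in
theorem IsSimplexSplitting.sum_pos (h : IsSimple η κ) (hS : IsSimplexSplitting η S c) (i : ι) :
    0 < ∑ j with S i j, c j * κ j := by
  obtain ⟨q, hq⟩ := h.exists_interior
  rw [← hS.sum_eq_zero i q]
  refine Finset.sum_lt_sum_of_nonempty ⟨i, by simp⟩ fun j _ => ?_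
  exact mul_lt_mul_of_pos_left (hq j) (hS.pos j)

open Classical in
-- Transposing two indices of one class preserves the class sums, hence all linear relations between
-- the rescaled conormals, so it is induced by a linear `f` independent of `κ'`. The hypothesis `hG`
-- lets the simple and smooth cases share the proof.
theorem IsSimplexSplitting.facetEquiv (h : IsSimple η κ) (hS : IsSimplexSplitting η S c) {i j : ι}
    (hij : S i j) (hG : ∀ f : V →ₗ[ℝ] V, (∀ k x, c k * η k (f x) =
      c (Equiv.swap i j k) * η (Equiv.swap i j k) x) → f ∈ G) :
    FacetEquiv G η κ i j := by
  set σ := Equiv.swap i j with hσ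
  have hσσ : ∀ k, σ (σ k) = k := fun k => Equiv.swap_apply_self i j k
  have hσS : ∀ k, S k (σ k) := by
    intro k
    by_cases hki : k = i
    · subst hki; rw [hσ, Equiv.swap_apply_left]; exact hij
    by_cases hkj : k = j
    · subst hkj; rw [hσ, Equiv.swap_apply_right]; exact S.symm hij
    rw [hσ, Equiv.swap_apply_of_ne_of_ne hki hkj]
  have hsum : ∀ (y : ι → ℝ) m, ∑ k with S m k, y (σ k) = ∑ k with S m k, y k := by
    intro y m
    refine Finset.sum_equiv σ (fun k => ?_) fun _ _ => rfl
    simp only [Finset.mem_filter, Finset.mem_univ, true_and]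
    exact ⟨fun hk => S.trans hk (hσS k), fun hk => S.trans hk (S.symm (hσS k))⟩
  let L : V →ₗ[ℝ] (ι → ℝ) := LinearMap.pi fun k => c k • η k
  have hL : ∀ x k, L x k = c k * η k x := fun x k => rfl
  have hker : LinearMap.ker L = ⊥ := by
    rw [LinearMap.ker_eq_bot']
    intro x hx
    refine h.eq_of_forall_apply_eq fun k => ?_
    have := congrFun hx k
    rw [hL] at this
    rw [map_zero]
    exact (mul_eq_zero.1 this).resolve_left (hS.pos k).ne'
  obtain ⟨g, hg⟩ := L.exists_leftInverse_of_injective hker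
  have hgL : ∀ x, g (L x) = x := fun x => congrArg (fun f => f x) hg
  have hLg : ∀ y : ι → ℝ, (∀ m, ∑ k with S m k, y k = 0) → L (g y) = y := by
    intro y hy
    obtain ⟨x, hx⟩ := hS.exists_apply_eq y hy
    have : L x = y := funext hx
    rw [← this, hgL]
  let f : V →ₗ[ℝ] V := g ∘ₗ (LinearMap.funLeft ℝ ℝ σ) ∘ₗ L
  have hf : ∀ k x, c k * η k (f x) = c (σ k) * η (σ k) x := by
    intro k x
    have := hLg (fun k => L x (σ k)) fun m => by
      rw [hsum (fun k => L x k)]; exact hS.sum_eq_zero m x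
    exact congrFun this k
  refine ⟨f, fun κ' _ => ?_⟩
  -- The translation part corrects the support numbers; its data has zero class sums because `σ`
  -- preserves classes.
  have hb := hLg (fun k => c k * κ' k - c (σ k) * κ' (σ k)) fun m => by
    rw [Finset.sum_sub_distrib, hsum fun k => c k * κ' k, sub_self]
  set b := g fun k => c k * κ' k - c (σ k) * κ' (σ k)
  let a : V →ᵃ[ℝ] V := f.toAffineMap + AffineMap.const ℝ V b
  have ha : ∀ k x, c k * (κ' k - η k (a x)) = c (σ k) * (κ' (σ k) - η (σ k) x) := by
    intro k x
    have e1 := congrFun hb k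
    rw [hL] at e1
    have e2 := hf k x
    have e3 : a x = f x + b := rfl
    rw [e3, map_add]
    linear_combination -e1 - e2
  have hinv : ∀ x, a (a x) = x := by
    intro x
    refine h.eq_of_forall_apply_eq fun k => ?_
    have e1 := ha k (a x)
    rw [ha (σ k) x, hσσ] at e1
    have := mul_left_cancel₀ (hS.pos k).ne' e1
    linarith
  have hP : ∀ x, x ∈ polytope η κ' → a x ∈ polytope η κ' := by
    intro x hx k
    have h1 : 0 ≤ c k * (κ' k - η k (a x)) := by
      rw [ha]; exact mul_nonneg (hS.pos _).le (sub_nonneg.2 (hx _))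
    exact sub_nonneg.1 (nonneg_of_mul_nonneg_right h1 (hS.pos k))
  have hF : ∀ k x, x ∈ facet η κ' (σ k) → a x ∈ facet η κ' k := by
    intro k x hx
    refine ⟨hP x hx.1, ?_⟩
    have h1 := ha k x
    rw [hx.2.out, sub_self, mul_zero] at h1
    exact (sub_eq_zero.1 ((mul_eq_zero.1 h1).resolve_left (hS.pos k).ne')).symm
  have hal : a.linear = f := by simp [a]
  refine ⟨a, ⟨hal ▸ hG f hf, ?_⟩, hal, ?_⟩
  · refine Set.Subset.antisymm ?_ fun x hx => ⟨a x, hP x hx, hinv x⟩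
    rintro _ ⟨x, hx, rfl⟩
    exact hP x hx
  · refine Set.Subset.antisymm ?_ fun x hx => ⟨a x, ?_, hinv x⟩
    · rintro _ ⟨x, hx, rfl⟩
      exact hF j x (by rwa [hσ, Equiv.swap_apply_right])
    · exact hF i x (by rwa [hσ, Equiv.swap_apply_left])

/-- The rescaled slacks over an `S`-class sum to a positive constant, so they have no common zero.
-/
theorem IsSimplexSplitting.iInter_facet_eq_empty (h : IsSimple η κ) (hS : IsSimplexSplitting η S c)
    {i : ι} (hi : ∀ j, S i j → FacetEquiv G η κ i j) :
    ⋂ j ∈ facetClass G η κ i, facet η κ j = ∅ := by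
  classical
  rw [Set.eq_empty_iff_forall_notMem]
  intro x hx
  simp only [Set.mem_iInter] at hx
  have h1 := hS.sum_pos h i
  have h2 := hS.sum_eq_zero i x
  have h3 : ∑ j with S i j, c j * η j x = ∑ j with S i j, c j * κ j := by
    refine Finset.sum_congr rfl fun j hj => ?_
    have : x ∈ facet η κ j := hx j (hi j (Finset.mem_filter.1 hj).2)
    rw [this.2.out]
  rw [← h3, h2] at h1
  exact lt_irrefl _ h1

open Classical in
theorem sum_class_eq {J : Type*} [Fintype J] {k : J → ℕ} (Ψ : (Σ j : J, Option (Fin (k j))) ≃ ι)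
    (hΨ : ∀ a b, S (Ψ a) (Ψ b) ↔ a.1 = b.1) (u : ι → ℝ) (a : Σ j : J, Option (Fin (k j))) :
    ∑ i with S (Ψ a) i, u i = u (Ψ ⟨a.1, none⟩) + ∑ l, u (Ψ ⟨a.1, some l⟩) := by
  rw [Finset.sum_filter, ← Ψ.sum_comp, Fintype.sum_sigma, Finset.sum_eq_single a.1]
  · simp only [hΨ, if_true, Fintype.sum_option]
  · intro j _ hj
    refine Finset.sum_eq_zero fun o _ => if_neg ?_
    rw [hΨ]
    exact hj.symm
  · exact fun hn => absurd (Finset.mem_univ _) hn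

theorem exists_equiv_sigma_option (S : Setoid ι) :
    ∃ (m : ℕ) (k : Fin m → ℕ) (Ψ : (Σ j : Fin m, Option (Fin (k j))) ≃ ι),
      ∀ a b, S (Ψ a) (Ψ b) ↔ a.1 = b.1 := by
  classical
  let e := Fintype.equivFin (Quotient S)
  let p : ι → Fin (Fintype.card (Quotient S)) := fun i => e ⟦i⟧
  have hne : ∀ j, Nonempty {i // p i = j} := by
    intro j
    obtain ⟨i, hi⟩ := Quotient.exists_rep (e.symm j)
    exact ⟨⟨i, by simp only [p]; rw [hi, Equiv.apply_symm_apply]⟩⟩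
  have hk : ∀ j, Fintype.card {i // p i = j} = Fintype.card {i // p i = j} - 1 + 1 := fun j => by
    have := hne j
    exact (Nat.succ_pred_eq_of_pos Fintype.card_pos).symm
  -- A class with `k + 1` members gives a `k`-simplex; `none` marks the facet that is not a
  -- coordinate hyperplane.
  let k : Fin (Fintype.card (Quotient S)) → ℕ := fun j => Fintype.card {i // p i = j} - 1
  let φ : ∀ j, Option (Fin (k j)) ≃ {i // p i = j} := fun j =>
    (finSuccEquiv (k j)).symm.trans (Fintype.equivFinOfCardEq (hk j)).symm
  let Ψ := (Equiv.sigmaCongrRight φ).trans (Equiv.sigmaFiberEquiv p)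
  have hΨ : ∀ a, p (Ψ a) = a.1 := fun a => (φ a.1 a.2).2
  refine ⟨_, k, Ψ, fun a b => ?_⟩
  rw [← hΨ a, ← hΨ b]
  exact ⟨fun hab => congrArg e (Quotient.sound hab), fun hab => Quotient.exact (e.injective hab)⟩

/-- The isomorphism with a product of simplices determined by a splitting. -/
theorem IsSimplexSplitting.exists_affineEquiv (h : IsSimple η κ) (hS : IsSimplexSplitting η S c) :
    ∃ (m : ℕ) (k : Fin m → ℕ) (r : Fin m → ℝ) (e : V ≃ᵃ[ℝ] ((j : Fin m) → Fin (k j) → ℝ)),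
      (∀ j, 0 < r j) ∧ e '' polytope η κ = simplexProduct k r ∧
      ∀ A : Set V, (∀ x, x ∈ A ↔ ∀ i, ∃ n : ℤ, c i * η i x = n) →
        e.linear '' A = {x : (j : Fin m) → Fin (k j) → ℝ | ∀ j i, ∃ n : ℤ, x j i = (n : ℝ)} := by
  classical
  obtain ⟨m, k, Ψ, hΨ⟩ := exists_equiv_sigma_option S
  have hsum0 : ∀ j x, c (Ψ ⟨j, none⟩) * η (Ψ ⟨j, none⟩) x =
      - ∑ l, c (Ψ ⟨j, some l⟩) * η (Ψ ⟨j, some l⟩) x := by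
    intro j x
    have := hS.sum_eq_zero (Ψ ⟨j, none⟩) x
    rw [sum_class_eq Ψ hΨ fun i => c i * η i x] at this
    linarith
  let Λ : V →ₗ[ℝ] ((j : Fin m) → Fin (k j) → ℝ) :=
    LinearMap.pi fun j => LinearMap.pi fun l => -(c (Ψ ⟨j, some l⟩) • η (Ψ ⟨j, some l⟩))
  have hΛ : ∀ x j l, Λ x j l = -(c (Ψ ⟨j, some l⟩) * η (Ψ ⟨j, some l⟩) x) := fun x j l => rfl
  have hinj : Function.Injective Λ := by
    rw [← LinearMap.ker_eq_bot, LinearMap.ker_eq_bot']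
    intro x hx
    have hsome : ∀ j l, c (Ψ ⟨j, some l⟩) * η (Ψ ⟨j, some l⟩) x = 0 := by
      intro j l
      have := hΛ x j l
      rw [hx] at this
      exact neg_eq_zero.1 this.symm
    refine h.eq_of_forall_apply_eq fun i => ?_
    rw [map_zero]
    refine (mul_eq_zero.1 (?_ : c i * η i x = 0)).resolve_left (hS.pos i).ne'
    obtain ⟨⟨j, o⟩, rfl⟩ := Ψ.surjective i
    cases o with
    | some l => exact hsome j l
    | none => rw [hsum0, Finset.sum_eq_zero fun l _ => hsome j l, neg_zero]
  have hsurj : Function.Surjective Λ := by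
    intro z
    let y : (Σ j : Fin m, Option (Fin (k j))) → ℝ := fun a =>
      match a with
      | ⟨j, some l⟩ => -z j l
      | ⟨j, none⟩ => ∑ l, z j l
    obtain ⟨x, hx⟩ := hS.exists_apply_eq (fun i => y (Ψ.symm i)) fun i => by
      obtain ⟨a, rfl⟩ := Ψ.surjective i
      rw [sum_class_eq Ψ hΨ]
      simp [y]
    refine ⟨x, ?_⟩
    funext j l
    rw [hΛ, hx]
    simp [y]
  let ΛE := LinearEquiv.ofBijective Λ ⟨hinj, hsurj⟩
  let t : (j : Fin m) → Fin (k j) → ℝ := fun j l => c (Ψ ⟨j, some l⟩) * κ (Ψ ⟨j, some l⟩)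
  let e : V ≃ᵃ[ℝ] ((j : Fin m) → Fin (k j) → ℝ) :=
    ΛE.toAffineEquiv.trans (AffineEquiv.constVAdd ℝ _ t)
  have he : ∀ x j l, e x j l = c (Ψ ⟨j, some l⟩) * (κ (Ψ ⟨j, some l⟩) - η (Ψ ⟨j, some l⟩) x) := by
    intro x j l
    have : e x j l = t j l + Λ x j l := rfl
    rw [this, hΛ]
    ring
  -- The size of the simplex is the constant sum of its rescaled slacks; the coordinates of `e` are
  -- the slacks indexed by `some l`.
  let r : Fin m → ℝ := fun j => c (Ψ ⟨j, none⟩) * κ (Ψ ⟨j, none⟩) +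
    ∑ l, c (Ψ ⟨j, some l⟩) * κ (Ψ ⟨j, some l⟩)
  have hnone : ∀ x j, r j - ∑ l, e x j l =
      c (Ψ ⟨j, none⟩) * (κ (Ψ ⟨j, none⟩) - η (Ψ ⟨j, none⟩) x) := by
    intro x j
    simp only [he, mul_sub, Finset.sum_sub_distrib, r]
    rw [hsum0]
    ring
  have hmem : ∀ x, x ∈ polytope η κ ↔ e x ∈ simplexProduct k r := by
    intro x
    have hi : ∀ i, η i x ≤ κ i ↔ 0 ≤ c i * (κ i - η i x) := fun i => by
      rw [mul_nonneg_iff_of_pos_left (hS.pos i), sub_nonneg]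
    constructor
    · intro hx j
      refine ⟨fun l => ?_, ?_⟩
      · rw [he, ← hi]; exact hx _
      · rw [← sub_nonneg, hnone, ← hi]; exact hx _
    · intro hx i
      obtain ⟨⟨j, o⟩, rfl⟩ := Ψ.surjective i
      cases o with
      | some l => rw [hi, ← he]; exact (hx j).1 l
      | none => rw [hi, ← hnone, sub_nonneg]; exact (hx j).2
  refine ⟨m, k, r, e, fun j => ?_, ?_, fun A hA => ?_⟩
  · have := hS.sum_pos h (Ψ ⟨j, none⟩)
    rwa [sum_class_eq Ψ hΨ] at this
  · ext z
    obtain ⟨x, rfl⟩ := e.surjective z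
    rw [← hmem]
    exact e.injective.mem_set_image
  · have hlin : ∀ x, e.linear x = Λ x := fun x => rfl
    ext z
    constructor
    · rintro ⟨x, hx, rfl⟩ j l
      obtain ⟨n, hn⟩ := (hA x).1 hx (Ψ ⟨j, some l⟩)
      refine ⟨-n, ?_⟩
      rw [hlin, hΛ, hn]
      push_cast
      rfl
    · intro hz
      obtain ⟨x, rfl⟩ := hsurj z
      refine ⟨x, (hA x).2 fun i => ?_, hlin x⟩
      choose n hn using hz
      have hsome : ∀ j l, c (Ψ ⟨j, some l⟩) * η (Ψ ⟨j, some l⟩) x = ((-n j l : ℤ) : ℝ) := by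
        intro j l
        have := hn j l
        rw [hΛ] at this
        push_cast
        linarith
      obtain ⟨⟨j, o⟩, rfl⟩ := Ψ.surjective i
      cases o with
      | some l => exact ⟨_, hsome j l⟩
      | none =>
        refine ⟨∑ l, n j l, ?_⟩
        rw [hsum0]
        simp only [hsome]
        push_cast
        rw [Finset.sum_neg_distrib, neg_neg]

end Splitting

/-! ### Products of simplices give splittings -/

section ProductOfSimplices

variable {V : Type*} [NormedAddCommGroup V] [NormedSpace ℝ V] [FiniteDimensional ℝ V]
  {ι : Type*} [Fintype ι] {η : ι → Module.Dual ℝ V} {κ : ι → ℝ}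

/-- The conormals of a product of simplices, in affine coordinates with linear part `Λ`. -/
noncomputable def simplexConormal {m : ℕ} {k : Fin m → ℕ}
    (Λ : V →ₗ[ℝ] ((j : Fin m) → Fin (k j) → ℝ)) :
    (Σ j : {j : Fin m // 0 < k j}, Option (Fin (k j.1))) → Module.Dual ℝ V
  | ⟨j, some l⟩ => -(LinearMap.proj l ∘ₗ LinearMap.proj j.1 ∘ₗ Λ)
  | ⟨j, none⟩ => ∑ l, LinearMap.proj l ∘ₗ LinearMap.proj j.1 ∘ₗ Λ

/-- The amount by which a point `z` satisfies the inequalities of a product of simplices. -/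
def simplexSlack {m : ℕ} {k : Fin m → ℕ} (r : Fin m → ℝ) (z : (j : Fin m) → Fin (k j) → ℝ) :
    (Σ j : {j : Fin m // 0 < k j}, Option (Fin (k j.1))) → ℝ
  | ⟨j, some l⟩ => z j.1 l
  | ⟨j, none⟩ => r j.1 - ∑ l, z j.1 l

theorem mem_simplexProduct_iff {m : ℕ} {k : Fin m → ℕ} {r : Fin m → ℝ} (hr : ∀ j, 0 < r j)
    (z : (j : Fin m) → Fin (k j) → ℝ) :
    z ∈ simplexProduct k r ↔ ∀ a, 0 ≤ simplexSlack r z a := by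
  constructor
  · rintro hz ⟨j, _ | l⟩
    · exact sub_nonneg.2 (hz j.1).2
    · exact (hz j.1).1 l
  · intro hz j
    refine ⟨fun l => hz ⟨⟨j, l.pos⟩, some l⟩, ?_⟩
    rcases Nat.eq_zero_or_pos (k j) with hj | hj
    · have : IsEmpty (Fin (k j)) := by rw [hj]; infer_instance
      rw [Finset.univ_eq_empty, Finset.sum_empty]
      exact (hr j).le
    · exact sub_nonneg.1 (hz ⟨⟨j, hj⟩, none⟩)

theorem sum_div_add_one_lt {r : ℝ} (hr : 0 < r) (n : ℕ) : ∑ _l : Fin n, r / (n + 1) < r := by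
  rw [Finset.sum_const, Finset.card_univ, Fintype.card_fin, nsmul_eq_mul, mul_div_assoc',
    div_lt_iff₀ (by positivity)]
  nlinarith

theorem exists_simplexSlack_pos {m : ℕ} {k : Fin m → ℕ} {r : Fin m → ℝ} (hr : ∀ j, 0 < r j) :
    ∃ z : (j : Fin m) → Fin (k j) → ℝ, ∀ a, 0 < simplexSlack r z a := by
  refine ⟨fun j _ => r j / (k j + 1), ?_⟩
  rintro ⟨j, _ | l⟩
  · exact sub_pos.2 (sum_div_add_one_lt (hr j.1) _)
  · exact div_pos (hr _) (by positivity)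

theorem exists_simplexSlack_eq_zero {m : ℕ} {k : Fin m → ℕ} {r : Fin m → ℝ} (hr : ∀ j, 0 < r j)
    (a : Σ j : {j : Fin m // 0 < k j}, Option (Fin (k j.1))) :
    ∃ z : (j : Fin m) → Fin (k j) → ℝ, simplexSlack r z a = 0 ∧
      ∀ b, b ≠ a → 0 < simplexSlack r z b := by
  classical
  obtain ⟨j, _ | l⟩ := a
  -- The barycenter of the slanted facet in block `j`, and an interior point in the other blocks.
  · refine ⟨fun j' _ => if j' = j.1 then r j' / k j' else r j' / (k j' + 1), ?_, ?_⟩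
    · have hk : (k j.1 : ℝ) ≠ 0 := Nat.cast_ne_zero.2 j.2.ne'
      simp only [simplexSlack, if_true, Finset.sum_const, Finset.card_univ, Fintype.card_fin,
        nsmul_eq_mul]
      rw [mul_div_cancel₀ _ hk, sub_self]
    · rintro ⟨j', _ | l'⟩ hb
      · have hj : j'.1 ≠ j.1 := fun he => hb (by rw [Subtype.ext he])
        simp only [simplexSlack, if_neg hj]
        exact sub_pos.2 (sum_div_add_one_lt (hr j'.1) _)
      · have hk : (0 : ℝ) < k j'.1 := Nat.cast_pos.2 j'.2
        simp only [simplexSlack]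
        split_ifs
        · exact div_pos (hr _) hk
        · exact div_pos (hr _) (by positivity)
  · refine ⟨fun j' l' => if (⟨j', l'⟩ : Σ j, Fin (k j)) = ⟨j.1, l⟩ then 0 else r j' / (k j' + 1),
      ?_, ?_⟩
    · simp [simplexSlack]
    · rintro ⟨j', _ | l'⟩ hb
      · refine sub_pos.2 (lt_of_le_of_lt (Finset.sum_le_sum fun l' _ => ?_)
          (sum_div_add_one_lt (hr j'.1) (k j'.1)))
        have : 0 ≤ r j'.1 / (k j'.1 + 1) := (div_pos (hr _) (by positivity)).le
        dsimp only
        split_ifs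
        · exact this
        · exact le_rfl
      · have hne : (⟨j'.1, l'⟩ : Σ j, Fin (k j)) ≠ ⟨j.1, l⟩ := by
          intro he
          apply hb
          obtain ⟨j', hj'⟩ := j'
          obtain ⟨j, hj⟩ := j
          simp only [Sigma.mk.injEq] at he
          obtain ⟨rfl, he⟩ := he
          rw [eq_of_heq he]
        simp only [simplexSlack, if_neg hne]
        exact div_pos (hr _) (by positivity)

/-- Both systems of inequalities are irredundant, so uniqueness gives a bijection between them up to
positive factors, which carries the obvious relations of the simplices to the conormals `η`. -/
theorem IsSimple.exists_isSimplexSplitting_of_isProductOfSimplices (h : IsSimple η κ)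
    (hP : IsProductOfSimplices (polytope η κ)) : ∃ S c, IsSimplexSplitting η S c := by
  classical
  obtain ⟨m, k, r, e, hr, he⟩ := hP
  -- Factors of dimension zero are dropped, since they contribute no facets.
  let K := Σ j : {j : Fin m // 0 < k j}, Option (Fin (k j.1))
  let Λ : V →ₗ[ℝ] ((j : Fin m) → Fin (k j) → ℝ) := e.linear
  have hΛ : ∀ x, e x = Λ x + e 0 := fun x => congrFun (AffineMap.decomp e.toAffineMap) x
  let θ : K → Module.Dual ℝ V := simplexConormal Λ
  let τ : K → ℝ := simplexSlack r (e 0)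
  have hθsome : ∀ (j : {j : Fin m // 0 < k j}) l x, θ ⟨j, some l⟩ x = -Λ x j.1 l :=
    fun _ _ _ => rfl
  have hθnone : ∀ (j : {j : Fin m // 0 < k j}) x, θ ⟨j, none⟩ x = ∑ l, Λ x j.1 l :=
    fun j x => by simp [θ, simplexConormal]
  have hslack : ∀ x a, simplexSlack r (e x) a = τ a - θ a x := by
    rintro x ⟨j, _ | l⟩
    · rw [hθnone]
      simp only [simplexSlack, hΛ x, τ, Pi.add_apply, Finset.sum_add_distrib]
      ring
    · rw [hθsome]
      simp only [simplexSlack, hΛ x, τ, Pi.add_apply]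
      ring
  have hpoly : polytope η κ = polytope θ τ := by
    ext x
    rw [← e.injective.mem_set_image (s := polytope η κ), he, mem_simplexProduct_iff hr]
    exact forall_congr' fun a => by rw [hslack, sub_nonneg]
  have hrel : ∀ a, ∃ p, θ a p = τ a ∧ ∀ b, b ≠ a → θ b p < τ b := by
    intro a
    obtain ⟨z, hz, hzb⟩ := exists_simplexSlack_eq_zero (k := k) hr a
    obtain ⟨p, rfl⟩ := e.surjective z
    rw [hslack] at hz
    refine ⟨p, (sub_eq_zero.1 hz).symm, fun b hb => ?_⟩
    rw [← sub_pos, ← hslack]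
    exact hzb b hb
  obtain ⟨q, hq⟩ := h.exists_interior
  obtain ⟨q', hq'⟩ : ∃ q', ∀ a, θ a q' < τ a := by
    obtain ⟨z, hz⟩ := exists_simplexSlack_pos (k := k) hr
    obtain ⟨p, rfl⟩ := e.surjective z
    exact ⟨p, fun a => by rw [← sub_pos, ← hslack]; exact hz a⟩
  -- Comparing the systems needs one point strict for both: move slightly from `q` towards `q'`.
  have hcommon : ∃ q, (∀ i, η i q < κ i) ∧ ∀ a, θ a q < τ a := by
    have hint : q ∈ interior (polytope θ τ) := by
      rw [← hpoly]
      exact interior_maximal (fun x hx j => (hx j).le) (isOpen_interior_polytope η κ) hq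
    have hc : Continuous fun t : ℝ => q + t • (q' - q) := by fun_prop
    have e1 : ∀ᶠ t in 𝓝 (0 : ℝ), ∀ i, η i q < κ i → η i (q + t • (q' - q)) < κ i :=
      eventually_lt_along η κ q _
    have e2 : ∀ᶠ t in 𝓝[>] (0 : ℝ), t < 1 ∧ 0 < t :=
      mem_of_superset (Ioo_mem_nhdsGT one_pos) fun t ht => ⟨ht.2, ht.1⟩
    obtain ⟨t, h1, h2, h3⟩ := ((e1.filter_mono nhdsWithin_le_nhds).and e2).exists
    refine ⟨q + t • (q' - q), fun i => h1 i (hq i), fun a => ?_⟩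
    have h4 := interior_subset hint a
    have h5 := hq' a
    rw [map_add, map_smul, map_sub, smul_eq_mul]
    nlinarith
  clear hq hq' q q'
  obtain ⟨q, hq, hq'⟩ := hcommon
  have h1 : ∀ i, ∃ a, ∃ c : ℝ, 0 < c ∧ ∀ x, θ a x = c * η i x := by
    intro i
    obtain ⟨p, hp, hpj⟩ := h.exists_relint i
    obtain ⟨a, c, hc, hx, -⟩ := exists_pos_smul_of_polytope_eq hpoly hq hq' hp hpj
    exact ⟨a, c, hc, hx⟩
  choose σ c hc hσ using h1
  have hinj : Function.Injective σ := by
    intro i i' hii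
    refine eq_of_pos_smul h.exists_relint (mul_pos (inv_pos.2 (hc i)) (hc i')) fun x => ?_
    rw [mul_assoc, ← hσ, ← hii, hσ, inv_mul_cancel_left₀ (hc i).ne']
  have hsurj : Function.Surjective σ := by
    intro a
    obtain ⟨p, hp, hpj⟩ := hrel a
    obtain ⟨i, d, hd, hx, -⟩ := exists_pos_smul_of_polytope_eq hpoly.symm hq' hq hp hpj
    refine ⟨i, eq_of_pos_smul hrel (mul_pos (hc i) hd) fun x => ?_⟩
    rw [hσ, hx, mul_assoc]
  let Ψ : K ≃ ι := (Equiv.ofBijective σ ⟨hinj, hsurj⟩).symm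
  have hΨ : ∀ a x, c (Ψ a) * η (Ψ a) x = θ a x := by
    intro a x
    rw [← hσ]
    congr 2
    exact (Equiv.ofBijective σ ⟨hinj, hsurj⟩).apply_symm_apply a
  let S : Setoid ι := Setoid.ker fun i => (Ψ.symm i).1
  have hS : ∀ a b, S (Ψ a) (Ψ b) ↔ a.1 = b.1 := by
    intro a b
    change (Ψ.symm (Ψ a)).1 = (Ψ.symm (Ψ b)).1 ↔ _
    simp only [Equiv.symm_apply_apply]
  refine ⟨S, c, hc, fun i x => ?_, fun y hy => ?_⟩
  · obtain ⟨a, rfl⟩ := Ψ.surjective i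
    rw [sum_class_eq Ψ hS fun i => c i * η i x]
    simp only [hΨ, hθsome, hθnone, Finset.sum_neg_distrib, add_neg_cancel]
  · let z : (j : Fin m) → Fin (k j) → ℝ := fun j l => -y (Ψ ⟨⟨j, l.pos⟩, some l⟩)
    obtain ⟨x, hx⟩ := e.linear.surjective z
    have hx' : Λ x = z := hx
    refine ⟨x, fun i => ?_⟩
    obtain ⟨⟨j, _ | l⟩, rfl⟩ := Ψ.surjective i
    · have := hy (Ψ ⟨j, none⟩)
      rw [sum_class_eq Ψ hS] at this
      rw [hΨ, hθnone, hx']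
      simp only [z, Finset.sum_neg_distrib]
      linarith
    · rw [hΨ, hθsome, hx', neg_neg]

end ProductOfSimplices

/-! ### The smooth case -/

section Lattice

variable {V : Type*} [NormedAddCommGroup V] [NormedSpace ℝ V] [FiniteDimensional ℝ V]
  {ι : Type*} [Fintype ι] {η : ι → Module.Dual ℝ V} {κ : ι → ℝ}
  {S : Setoid ι} {c : ι → ℝ} {ℓ : Submodule ℤ (Module.Dual ℝ V)}

theorem isLinearGroup_univ : IsLinearGroup (Set.univ : Set (V →ₗ[ℝ] V)) :=
  ⟨trivial, fun _ _ _ _ => trivial, fun _ _ _ _ => trivial⟩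

theorem isLinearGroup_latticeMaps (ℓ : Submodule ℤ (Module.Dual ℝ V)) :
    IsLinearGroup (latticeMaps ℓ) where
  id_mem := by simp [latticeMaps]
  comp_mem f hf g hg := by
    change (f ∘ₗ g) '' dualLattice ℓ = dualLattice ℓ
    rw [LinearMap.coe_comp, Set.image_comp, hg.out, hf.out]
  inv_mem f hf g hg := by
    change g '' dualLattice ℓ = dualLattice ℓ
    have : ∀ x, g (f x) = x := fun x => congrArg (fun u => u x) hg
    conv_lhs => rw [← hf.out]
    rw [Set.image_image]
    simp only [this, Set.image_id']

/-- Omitting one facet from each class gives the facets through a vertex. -/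
theorem IsSimplexSplitting.exists_vertex (h : IsSimple η κ) (hS : IsSimplexSplitting η S c)
    (rep : ι → ι) (hrep : ∀ i, S i (rep i)) (hrep' : ∀ i j, S i j → rep i = rep j) :
    ∃ v ∈ (polytope η κ).extremePoints ℝ, ∀ i, η i v = κ i ↔ i ≠ rep i := by
  classical
  let T : ι → ℝ := fun i => ∑ j with S i j, c j * κ j
  have hT : ∀ i j, S i j → T i = T j := by
    intro i j hij
    refine Finset.sum_congr (Finset.filter_congr fun l _ => ?_) fun _ _ => rfl
    exact ⟨fun hl => S.trans (S.symm hij) hl, fun hl => S.trans hij hl⟩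
  -- The whole slack `T i` of each class is assigned to its omitted facet.
  obtain ⟨v, hv⟩ := hS.exists_apply_eq (fun i => c i * κ i - if i = rep i then T i else 0) fun i => by
    have e : ∑ j with S i j, (if j = rep j then T j else 0) = T i := by
      rw [Finset.sum_eq_single (rep i)]
      · rw [if_pos (hrep' i (rep i) (hrep i)), ← hT i _ (hrep i)]
      · intro j hj hne
        refine if_neg fun he => hne ?_
        rw [he, hrep' i j (Finset.mem_filter.1 hj).2]
      · intro hn
        exact absurd (Finset.mem_filter.2 ⟨Finset.mem_univ _, hrep i⟩) hn
    rw [Finset.sum_sub_distrib, e]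
    exact sub_self _
  have hTpos : ∀ i, 0 < T i := hS.sum_pos h
  have hact : ∀ i, i ≠ rep i → η i v = κ i := by
    intro i hi
    have := hv i
    rw [if_neg hi, sub_zero] at this
    exact mul_left_cancel₀ (hS.pos i).ne' this
  have hinact : ∀ i, i = rep i → η i v < κ i := by
    intro i hi
    have := hv i
    rw [if_pos hi] at this
    exact lt_of_mul_lt_mul_left (by linarith [hTpos i]) (hS.pos i).le
  have hvP : v ∈ polytope η κ := by
    intro i
    by_cases hi : i = rep i
    · exact (hinact i hi).le
    · exact (hact i hi).le
  refine ⟨v, (mem_extremePoints_polytope_iff hvP).2 fun w hw => ?_, fun i =>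
    ⟨fun hi hi' => (hinact i hi').ne hi, hact i⟩⟩
  refine h.eq_of_forall_apply_eq fun i => ?_
  rw [map_zero]
  by_cases hi : i = rep i
  · have hsum := hS.sum_eq_zero i w
    rw [Finset.sum_eq_single i] at hsum
    · exact (mul_eq_zero.1 hsum).resolve_left (hS.pos i).ne'
    · intro j hj hne
      rw [hw j (hact j fun he => hne ?_), mul_zero]
      rw [he, ← hrep' i j (Finset.mem_filter.1 hj).2, ← hi]
    · intro hn
      exact absurd (Finset.mem_filter.2 ⟨Finset.mem_univ _, S.refl i⟩) hn
  · exact hw i (hact i hi)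

/-- For a smooth polytope the splitting can be taken with the primitive conormals. -/
theorem IsSmooth.exists_isSimplexSplitting (hsm : IsSmooth ℓ η κ)
    (hS : IsSimplexSplitting η S c) :
    ∃ c', IsSimplexSplitting η S c' ∧
      ∀ x, x ∈ dualLattice ℓ ↔ ∀ i, ∃ n : ℤ, c' i * η i x = n := by
  classical
  obtain ⟨h, ζ, hζ, hprim, hvert⟩ := hsm
  choose d hd hdζ using hζ
  have hζx : ∀ i x, ζ i x = d i * η i x := fun i x => by rw [hdζ]; rfl
  -- At the vertex omitting `i` from its class, the primitive conormals generate `ℓ`. The test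
  -- vector `x` sees only `j` among them, so `ζ i x = -(d i / c i)` is an integer multiple of `ζ j x
  -- = d j / c j`.
  have hratio : ∀ i j, S i j → ∃ n : ℤ, c j / d j = n * (c i / d i) := by
    intro i j hij
    by_cases hne : j = i
    · subst hne; exact ⟨1, by simp⟩
    let rep : ι → ι := fun l => if S i l then i else (⟦l⟧ : Quotient S).out
    have hout : ∀ l, S l (⟦l⟧ : Quotient S).out := fun l => S.symm (Quotient.mk_out l)
    have hrep : ∀ l, S l (rep l) := by
      intro l
      simp only [rep]
      split_ifs with hl
      · exact S.symm hl
      · exact hout l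
    have hrep' : ∀ l l', S l l' → rep l = rep l' := by
      intro l l' hll
      have : S i l ↔ S i l' := ⟨fun hl => S.trans hl hll, fun hl => S.trans hl (S.symm hll)⟩
      simp only [rep, this, (Quotient.sound hll : (⟦l⟧ : Quotient S) = ⟦l'⟧)]
    have hri : rep i = i := if_pos (S.refl i)
    obtain ⟨v, hv, hact⟩ := hS.exists_vertex h rep hrep hrep'
    obtain ⟨x, hx⟩ := hS.exists_apply_eq
      (fun l => (if l = j then 1 else 0) - if l = i then 1 else 0) fun l => by
        have hiff : S l j ↔ S l i :=
          ⟨fun hl => S.trans hl (S.symm hij), fun hl => S.trans hl hij⟩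
        simp only [Finset.sum_sub_distrib, Finset.sum_ite_eq', Finset.mem_filter, Finset.mem_univ,
          true_and, hiff, sub_self]
    have hspan : ∀ θ ∈ ℓ, ∃ n : ℤ, θ x = n * (d j / c j) := by
      intro θ hθ
      rw [← (hvert v hv).2] at hθ
      induction hθ using Submodule.span_induction with
      | mem θ hθ =>
        obtain ⟨⟨l, hl⟩, rfl⟩ := hθ
        have hli : l ≠ i := by
          rintro rfl
          exact (hact l).1 hl.2 hri.symm
        have hxl := hx l
        rw [if_neg hli, sub_zero] at hxl
        by_cases hlj : l = j
        · subst hlj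
          refine ⟨1, ?_⟩
          rw [if_pos rfl] at hxl
          change ζ l x = _
          rw [hζx, Int.cast_one, one_mul, eq_div_iff (hS.pos l).ne']
          linear_combination d l * hxl
        · refine ⟨0, ?_⟩
          rw [if_neg hlj] at hxl
          rw [hζx, (mul_eq_zero.1 hxl).resolve_left (hS.pos l).ne']
          simp
      | zero => exact ⟨0, by simp⟩
      | add θ θ' _ _ h1 h2 =>
        obtain ⟨n, hn⟩ := h1
        obtain ⟨n', hn'⟩ := h2
        exact ⟨n + n', by rw [LinearMap.add_apply, hn, hn']; push_cast; ring⟩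
      | smul a θ _ h1 =>
        obtain ⟨n, hn⟩ := h1
        exact ⟨a * n, by rw [LinearMap.smul_apply, hn, zsmul_eq_mul]; push_cast; ring⟩
    obtain ⟨n, hn⟩ := hspan (ζ i) (hprim i).1
    have hxi := hx i
    rw [if_neg (Ne.symm hne), if_pos rfl, zero_sub] at hxi
    refine ⟨-n, ?_⟩
    have hci := (hS.pos i).ne'
    have hcj := (hS.pos j).ne'
    have hdi := (hd i).ne'
    have hdj := (hd j).ne'
    rw [hζx] at hn
    have hηi : η i x = -1 / c i := by rw [eq_div_iff hci, mul_comm, hxi]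
    rw [hηi] at hn
    field_simp at hn
    push_cast
    field_simp
    linarith
  have hconst : ∀ i j, S i j → c j / d j = c i / d i := by
    intro i j hij
    obtain ⟨n, hn⟩ := hratio i j hij
    obtain ⟨n', hn'⟩ := hratio j i (S.symm hij)
    have hi : 0 < c i / d i := div_pos (hS.pos i) (hd i)
    have hj : 0 < c j / d j := div_pos (hS.pos j) (hd j)
    have hn0 : (0 : ℝ) < n := by
      rw [hn] at hj
      exact pos_of_mul_pos_left hj hi.le
    have hnn : (n' : ℝ) * n = 1 := by
      rw [hn, ← mul_assoc] at hn'
      exact (mul_eq_right₀ hi.ne').1 hn'.symm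
    have hnn' : n' * n = 1 := by exact_mod_cast hnn
    -- The ratios in both orders are positive integers with product one.
    have hn1 : n = 1 := by
      rcases Int.eq_one_or_neg_one_of_mul_eq_one' hnn' with h1 | h1
      · exact h1.2
      · rw [h1.2] at hn0
        norm_num at hn0
    rw [hn, hn1, Int.cast_one, one_mul]
  have hc : ∀ i, c i = c i / d i * d i := fun i => (div_mul_cancel₀ _ (hd i).ne').symm
  refine ⟨d, ⟨hd, fun i x => ?_, fun y hy => ?_⟩, fun x => ?_⟩
  · have := hS.sum_eq_zero i x
    have h2 : ∑ j with S i j, c j * η j x = c i / d i * ∑ j with S i j, d j * η j x := by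
      rw [Finset.mul_sum]
      refine Finset.sum_congr rfl fun j hj => ?_
      rw [hc j, hconst i j (Finset.mem_filter.1 hj).2, mul_assoc]
    rw [h2] at this
    exact (mul_eq_zero.1 this).resolve_left (div_pos (hS.pos i) (hd i)).ne'
  · obtain ⟨x, hx⟩ := hS.exists_apply_eq (fun i => c i / d i * y i) fun i => by
      have h2 : ∑ j with S i j, c j / d j * y j = c i / d i * ∑ j with S i j, y j := by
        rw [Finset.mul_sum]
        refine Finset.sum_congr rfl fun j hj => ?_
        rw [hconst i j (Finset.mem_filter.1 hj).2]
      rw [h2, hy, mul_zero]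
    refine ⟨x, fun i => ?_⟩
    have h3 := hx i
    rw [hc i, mul_assoc] at h3
    simp only [div_mul_cancel₀ _ (hd i).ne'] at h3
    exact mul_left_cancel₀ (div_pos (hS.pos i) (hd i)).ne' h3
  · constructor
    · intro hx i
      rw [← hζx]
      exact hx _ (hprim i).1
    · intro hx θ hθ
      obtain ⟨v, hv⟩ := h.exists_vertex
      rw [← (hvert v hv).2] at hθ
      induction hθ using Submodule.span_induction with
      | mem θ hθ =>
        obtain ⟨l, rfl⟩ := hθ
        simp only [hζx]
        exact hx l.1
      | zero => exact ⟨0, by simp⟩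
      | add θ θ' _ _ h1 h2 =>
        obtain ⟨n, hn⟩ := h1
        obtain ⟨n', hn'⟩ := h2
        exact ⟨n + n', by rw [LinearMap.add_apply, hn, hn']; push_cast; ring⟩
      | smul a θ _ h1 =>
        obtain ⟨n, hn⟩ := h1
        exact ⟨a * n, by rw [LinearMap.smul_apply, hn, zsmul_eq_mul]; push_cast; ring⟩

/-- The involution `f` only permutes the integrality conditions that define the dual lattice. -/
theorem IsSimplexSplitting.facetEquiv_latticeMaps (h : IsSimple η κ)
    (hS : IsSimplexSplitting η S c)
    (hℓ : ∀ x, x ∈ dualLattice ℓ ↔ ∀ i, ∃ n : ℤ, c i * η i x = n) {i j : ι} (hij : S i j) :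
    FacetEquiv (latticeMaps ℓ) η κ i j := by
  classical
  refine hS.facetEquiv h hij fun f hf => ?_
  have hm : ∀ x ∈ dualLattice ℓ, f x ∈ dualLattice ℓ := by
    intro x hx
    rw [hℓ] at hx ⊢
    intro k
    rw [hf]
    exact hx _
  have hinv : ∀ x, f (f x) = x := by
    intro x
    refine h.eq_of_forall_apply_eq fun k => ?_
    have := hf k (f x)
    rw [hf (Equiv.swap i j k) x, Equiv.swap_apply_self] at this
    exact mul_left_cancel₀ (hS.pos k).ne' this
  refine Set.Subset.antisymm ?_ fun x hx => ⟨f x, hm x hx, hinv x⟩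
  rintro _ ⟨x, hx, rfl⟩
  exact hm x hx

end Lattice

end MassLinear

/-! ### The cycle of implications -/

open MassLinear
theorem theorem1p9 {V : Type*} [NormedAddCommGroup V] [NormedSpace ℝ V] [FiniteDimensional ℝ V]
    [MeasurableSpace V] [BorelSpace V] (μ : MeasureTheory.Measure V) [μ.IsAddHaarMeasure]
    {ι : Type*} [Fintype ι] (η : ι → Module.Dual ℝ V) (κ : ι → ℝ) :
    (IsSimple η κ →
      List.TFAE [
        ∀ H : Module.Dual ℝ V, IsMassLinear μ η κ H,
        ∀ H : Module.Dual ℝ V, IsInessential Set.univ η κ H,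
        IsProductOfSimplices (polytope η κ),
        ∀ i, ⋂ j ∈ facetClass Set.univ η κ i, facet η κ j = ∅] ∧
      ((∀ i, ⋂ j ∈ facetClass Set.univ η κ i, facet η κ j = ∅) →
        ∀ i, 1 < (facetClass Set.univ η κ i).ncard)) ∧
    (∀ ℓ : Submodule ℤ (Module.Dual ℝ V), IsIntegerLattice ℓ → IsSmooth ℓ η κ →
      List.TFAE [
        ∀ H : Module.Dual ℝ V, IsMassLinear μ η κ H,
        ∀ H : Module.Dual ℝ V, IsInessential (latticeMaps ℓ) η κ H,
        IsLatticeProductOfSimplices ℓ (polytope η κ),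
        ∀ i, ⋂ j ∈ facetClass (latticeMaps ℓ) η κ i, facet η κ j = ∅] ∧
      ((∀ i, ⋂ j ∈ facetClass (latticeMaps ℓ) η κ i, facet η κ j = ∅) →
        ∀ i, 1 < (facetClass (latticeMaps ℓ) η κ i).ncard)) := by
  constructor
  · intro h
    have hG := isLinearGroup_univ (V := V)
    refine ⟨?_, h.one_lt_ncard_facetClass hG⟩
    tfae_have 4 → 2 := fun h4 H => h.isInessential_of_iInter_facet μ hG h4 H
    tfae_have 2 → 1 := fun h2 H => h.isMassLinear_of_isInessential μ hG (h2 H)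
    tfae_have 1 → 3 := by
      intro h1
      obtain ⟨S, c, hS⟩ := h.exists_isSimplexSplitting_of_isMassLinear μ h1
      obtain ⟨m, k, r, e, hr, he, -⟩ := hS.exists_affineEquiv h
      exact ⟨m, k, r, e, hr, he⟩
    tfae_have 3 → 4 := by
      intro h3 i
      obtain ⟨S, c, hS⟩ := h.exists_isSimplexSplitting_of_isProductOfSimplices h3
      exact hS.iInter_facet_eq_empty h fun j hij => hS.facetEquiv h hij fun _ _ => trivial
    tfae_finish
  · intro ℓ _ hsm
    have h := hsm.1
    have hG := isLinearGroup_latticeMaps ℓ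
    refine ⟨?_, h.one_lt_ncard_facetClass hG⟩
    tfae_have 4 → 2 := fun h4 H => h.isInessential_of_iInter_facet μ hG h4 H
    tfae_have 2 → 1 := fun h2 H => h.isMassLinear_of_isInessential μ hG (h2 H)
    tfae_have 1 → 3 := by
      intro h1
      obtain ⟨S, c, hS⟩ := h.exists_isSimplexSplitting_of_isMassLinear μ h1
      obtain ⟨c', hS', hℓ⟩ := hsm.exists_isSimplexSplitting hS
      obtain ⟨m, k, r, e, hr, he, hA⟩ := hS'.exists_affineEquiv h
      exact ⟨m, k, r, e, hr, he, hA _ hℓ⟩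
    tfae_have 3 → 4 := by
      rintro ⟨m, k, r, e, hr, he, -⟩ i
      -- The real product structure suffices: smoothness of `Δ` alone replaces the factors by those
      -- of the primitive conormals.
      obtain ⟨S, c, hS⟩ := h.exists_isSimplexSplitting_of_isProductOfSimplices ⟨m, k, r, e, hr, he⟩
      obtain ⟨c', hS', hℓ⟩ := hsm.exists_isSimplexSplitting hS
      exact hS'.iInter_facet_eq_empty h fun j hij => hS'.facetEquiv_latticeMaps h hℓ hij
    tfae_finish
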